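/- **Setting.** Let $V$ be a set of data points and $H$ a set of hypotheses. Let $\mathsf{learn}$ be a randomized algorithm that maps a finite sequence (dataset) $D$ over $V$ to a hypothesis in $H$, and let $\mathsf{delete}$ be an exact data deletion operation for it: for every dataset $D$ and every index $i$ of $D$, the outputs of $\mathsf{delete}(D,\mathsf{learn}(D),i)$ and of $\mathsf{learn}(D_{-i})$ are identically distributed, where $D_{-i}$ is $D$ without its $i$-th entry. For every security parameter $\lambda$ let $\mathsf{Dict}_\lambda$ be a history-independent (possibly randomized) implementation of a dictionary with keys in $\{0,1\}^\lambda$ and values in $V$: any two sequences of insert, lookup and delete operations that produce the same content induce the same distribution on the memory representation. (Inserting under a key in use does nothing.) A dictionary is passed to $\mathsf{learn}$ and $\mathsf{delete}$ as the sequence of its values in increasing order of the keys, and a key as the index of its entry. **The collector.** The state of the collector $X$ is $(\mathsf{Dict}_\lambda, thr, count, learnt, model)$. Initially the dictionary is empty, $thr$ is uniform in $\{\lambda,\dots,2\lambda\}$, $count=0$, $learnt=\mathsf{false}$, $model=\bot$. * In an instance of the protocol $\pi$ the client sends a value $v\in V$. $X$ samples a uniform $key\in\{0,1\}^\lambda$.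 If $learnt=\mathsf{false}$, it inserts $(key,v)$ into the dictionary, increments $count$ if an entry was really inserted, and then, if $count=thr$, sets $model\leftarrow\mathsf{learn}(\mathsf{Dict}_\lambda)$ and $learnt\leftarrow\mathsf{true}$. In all cases it replies with $key$, which is also the deletion token of the instance. * In an instance of the deletion protocol $\pi_D$ the client sends a key. $X$ looks it up; if it is in use, $X$ replaces $model$ by $\mathsf{delete}(\mathsf{Dict}_\lambda,model,key)$ (by $\bot$ if $model=\bot$), deletes the entry, decrements $count$ and, if $learnt=\mathsf{true}$, also $thr$. There is no reply. **Executions.** The environment $Z$ is an arbitrary randomized machine that repeatedly runs an instance of $\pi$ or $\pi_D$ with an arbitrary client message, or sends an arbitrary message to the deletion-requester $Y$, or activates $Y$ or $X$, or ends the execution. When activated, $Y$ (a randomized machine that sees the messages from $Z$ and the replies to its own instances, and that sends nothing to $Z$) may run instances of $\pi$ with arbitrary inputs, and instances of $\pi_D$ with the deletion tokens of its own instances of $\pi$; activation returns to $Z$ when $Y$ halts or when an instance of $Y$ ends without a reply. At the end, $\pi_D$ is run for every completed instance of $\pi$ of $Y$ for which $Y$ did not yet run it. $Z$ and $Y$ are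 given $\lambda$ and make at most polynomially many moves in $\lambda$ ($Y$: per activation by $Z$); their internal computations are unrestricted, so all PPT machines are included. In the ideal execution $Y$ is replaced by the silent $Y_0$, which halts whenever it is activated. $Y$ is $1$-representative if, in every execution with $X$, it initiates at most one instance of $\pi$. Let $(\mathrm{state}_X^{R,\lambda},\mathrm{view}_Z^{R,\lambda})$ and $(\mathrm{state}_X^{I,\lambda},\mathrm{view}_Z^{I,\lambda})$ be the state of $X$ and the view of $Z$ (its randomness and all messages it sent and received) at the end of the real and of the ideal execution. The $1$-representative deletion-compliance error of $X$ is $$\varepsilon(\lambda)=\sup_{Z,Y,D}\left|\Pr[D(\mathrm{state}_X^{R,\lambda},\mathrm{view}_Z^{R,\lambda})=1]-\Pr[D(\mathrm{state}_X^{I,\lambda},\mathrm{view}_Z^{I,\lambda})=1]\right|,$$ over all such $Z$, all such $1$-representative $Y$ and all unbounded randomized distinguishers $D$. **Theorem.** There is a polynomial $p$ such that for all $\lambda\ge 1$ $$\varepsilon(\lambda)\le\frac1\lambda+\frac{p(\lambda)}{2^\lambda}.$$ -/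

import Mathlib

/-! ### Data collectors, environments and deletion-requesters

All parties are probabilistic interactive machines.  A machine is described by what it does on each
activation, so no bound is put on its internal computation; the number of its activations is bounded
explicitly.  Each protocol instance consists of one message from the client, which the honest server
writes on its output tape for the collector, and at most one message back, which the collector writes
on the input tape of the server and the server forwards.  As activation is passed on by writing, such
an instance runs from the client's message to the reply without interruption. -/

/-- What a server-side instance writes on its output tape for the collector: an instance of `π`
delivers a data point, an instance of `π_D` delivers a deletion token. -/
inductive Request (V T : Type*) where
  | insert (value : V)
  | delete (token : T)

/-- A data collector `(X, π, π_D)`, for one value of the security parameter.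
`State` is the content of the work tape of `X`. -/
structure DataCollector (V : Type*) where
  State : Type*
  /-- messages from server to client -/
  Reply : Type
  /-- deletion tokens -/
  Token : Type
  /-- the initial set-up of `X` -/
  setup : PMF State
  /-- one activation of `X`: it reads the one output of a server-side instance that is still unread
  (`none` if there is none), updates its work tape, and possibly answers to that instance -/
  activate : Option (Request V Token) → State → PMF (State × Option Reply)
  /-- the deletion token of a completed instance of `π`, a function of its transcript -/
  token : V → Reply → Token

/-- The actions of the environment. It may send arbitrary client messages in instances of `π` and
`π_D`, so the client sides of its instances are simulated by the environment itself. -/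
inductive EnvAction (V T M : Type*) where
  /-- write `m` on the incoming tape of the deletion-requester, which is activated -/
  | message (m : M)
  | activateRequester
  | activateCollector
  /-- run an instance of `π` with client message `value` -/
  | collect (value : V)
  /-- run an instance of `π_D` with client message `token` -/
  | delete (token : T)
  /-- declare the end of the alive phase -/
  | finish

/-- What the environment sees during the execution, besides its randomness:
all its actions so far, each with the reply received from the collector, if any. -/
abbrev EnvLog {V : Type*} (C : DataCollector V) (M : Type*) :=
  List (EnvAction V C.Token M × Option C.Reply)

/-- An environment `Z`: it samples its randomness tape, and each action is determined by this tape
and by what it has seen. It makes at most `budget` actions, then it halts. -/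
structure Environment {V : Type*} (C : DataCollector V) (M : Type*) where
  Rand : Type
  coins : PMF Rand
  act : Rand → EnvLog C M → EnvAction V C.Token M
  budget : ℕ

/-- The view of the environment: randomness tape, and all messages sent and received. -/
abbrev Environment.View {V M : Type*} {C : DataCollector V} (Z : Environment C M) :=
  Z.Rand × EnvLog C M

/-- The actions of a deletion-requester. It runs the honest clients of `π` and `π_D`, and it can
request the deletion only of an instance of `π` that it has itself initiated. -/
inductive RequesterAction (V : Type*) where
  /-- run an instance of `π` with client input `value` -/
  | collect (value : V)
  /-- run an instance of `π_D` with the deletion token of its own `j`-th instance of `π` -/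
  | delete (j : ℕ)
  | halt

/-- The events on which a deletion-requester is activated: by the environment, with or without a
message, or by the client side of one of its own instances outputting a reply of the collector. -/
inductive RequesterEvent (R M : Type*) where
  | activated (message : Option M)
  | reply (r : R)

/-- A deletion-requester `Y`: each action is determined by its randomness tape and by the events so
far. It makes at most `budget` actions each time the environment activates it. -/
structure DeletionRequester {V : Type*} (C : DataCollector V) (M : Type*) where
  Rand : Type
  coins : PMF Rand
  act : Rand → List (RequesterEvent C.Reply M) → RequesterAction V
  budget : ℕ

/-- The silent deletion-requester `Y₀`. -/
noncomputable def DeletionRequester.silent {V : Type*} (C : DataCollector V) (M : Type*) :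
    DeletionRequester C M where
  Rand := Unit
  coins := PMF.pure ()
  act _ _ := .halt
  budget := 1

/-- The deletion-requester during an execution. -/
structure RequesterState {V : Type*} (C : DataCollector V) (M : Type*) where
  /-- the events so far -/
  log : List (RequesterEvent C.Reply M)
  /-- the instances of `π` it has initiated, in order: the deletion token (`none` if the instance was
  not completed), and whether an instance of `π_D` was already initiated for it -/
  instances : List (Option C.Token × Bool)

/-- A run of the deletion-requester, with at most the given number of actions, until activation
returns to the environment: this happens when it halts, or when one of its instances ends without a
reply. -/
noncomputable def DeletionRequester.run {V M : Type*} {C : DataCollector V}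
    (Y : DeletionRequester C M) (ρ : Y.Rand) :
    ℕ → RequesterState C M → C.State → PMF (RequesterState C M × C.State)
  | 0, y, s => PMF.pure (y, s)
  | n + 1, y, s =>
    match Y.act ρ y.log with
    | .halt => PMF.pure (y, s)
    | .collect v =>
      (C.activate (some (.insert v)) s).bind fun (s', r) =>
        match r with
        | none => PMF.pure ({ y with instances := y.instances ++ [(none, false)] }, s')
        | some r =>
          Y.run ρ n
            { log := y.log ++ [.reply r]
              instances := y.instances ++ [(some (C.token v r), false)] } s'
    | .delete j =>
      match y.instances[j]? with
      | some (some t, _) =>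
        (C.activate (some (.delete t)) s).bind fun (s', r) =>
          match r with
          | none => PMF.pure ({ y with instances := y.instances.set j (some t, true) }, s')
          | some r =>
            Y.run ρ n
              { log := y.log ++ [.reply r]
                instances := y.instances.set j (some t, true) } s'
      | _ => PMF.pure (y, s)

/-- A configuration of the system between two activations of the environment. -/
structure Config {V : Type*} (C : DataCollector V) (M : Type*) where
  envLog : EnvLog C M
  requester : RequesterState C M
  collector : C.State

/-- Effect of one action of the environment; activation then returns to the environment. -/
noncomputable def envStep {V M : Type*} {C : DataCollector V} (Y : DeletionRequester C M)
    (ρ : Y.Rand) (a : EnvAction V C.Token M) (c : Config C M) : PMF (Config C M) :=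
  let activateRequester (m : Option M) : PMF (Config C M) :=
    (Y.run ρ Y.budget { c.requester with log := c.requester.log ++ [.activated m] }
      c.collector).map fun (y, s) => ⟨c.envLog ++ [(a, none)], y, s⟩
  match a with
  | .finish => PMF.pure { c with envLog := c.envLog ++ [(a, none)] }
  | .message m => activateRequester (some m)
  | .activateRequester => activateRequester none
  | .activateCollector =>
    (C.activate none c.collector).map fun (s, _) => ⟨c.envLog ++ [(a, none)], c.requester, s⟩
  | .collect v =>
    (C.activate (some (.insert v)) c.collector).map fun (s, r) =>
      ⟨c.envLog ++ [(a, r)], c.requester, s⟩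
  | .delete t =>
    (C.activate (some (.delete t)) c.collector).map fun (s, r) =>
      ⟨c.envLog ++ [(a, r)], c.requester, s⟩

/-- The alive phase with at most the given number of actions of the environment. -/
noncomputable def alivePhase {V M : Type*} {C : DataCollector V} (Z : Environment C M)
    (Y : DeletionRequester C M) (ρZ : Z.Rand) (ρY : Y.Rand) : ℕ → Config C M → PMF (Config C M)
  | 0, c => PMF.pure c
  | n + 1, c =>
    match Z.act ρZ c.envLog with
    | .finish => envStep Y ρY .finish c
    | a => (envStep Y ρY a c).bind (alivePhase Z Y ρZ ρY n)

/-- The terminate phase: for each completed instance of `π` of the deletion-requester for which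
`π_D` was not yet initiated, an instance of `π_D` is run with its deletion token. -/
noncomputable def terminatePhase {V : Type*} (C : DataCollector V) :
    List (Option C.Token × Bool) → C.State → PMF C.State
  | [], s => PMF.pure s
  | (some t, false) :: l, s =>
    (C.activate (some (.delete t)) s).bind fun (s', _) => terminatePhase C l s'
  | _ :: l, s => terminatePhase C l s

/-- The outcome of the alive phase, with the randomness of the environment. -/
noncomputable def aliveOutcome {V M : Type*} {C : DataCollector V} (Z : Environment C M)
    (Y : DeletionRequester C M) : PMF (Z.Rand × Config C M) :=
  Z.coins.bind fun ρZ => Y.coins.bind fun ρY => C.setup.bind fun s =>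
    (alivePhase Z Y ρZ ρY Z.budget ⟨[], ⟨[], []⟩, s⟩).map fun c => (ρZ, c)

/-- The joint distribution of the state of `X` and the view of `Z` at the end of the execution with
deletion-requester `Y`. -/
noncomputable def exec {V M : Type*} {C : DataCollector V} (Z : Environment C M)
    (Y : DeletionRequester C M) : PMF (C.State × Z.View) :=
  (aliveOutcome Z Y).bind fun (ρZ, c) =>
    (terminatePhase C c.requester.instances c.collector).map fun s => (s, (ρZ, c.envLog))

/-- `Y` is `k`-representative: interacting with the collector, it never initiates more than `k`
instances of `π`. -/
def DeletionRequester.IsRepresentative {V : Type*} {M : Type*} {C : DataCollector V}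
    (Y : DeletionRequester C M) (k : ℕ) : Prop :=
  ∀ Z : Environment C M, ∀ o ∈ (aliveOutcome Z Y).support, o.2.requester.instances.length ≤ k

/-- A bound in terms of the security parameter that is at most polynomial. -/
def PolynomiallyBounded (b : ℕ → ℕ) : Prop :=
  ∃ p : Polynomial ℕ, ∀ secp, b secp ≤ p.eval secp

/-- The advantage of the (randomized, unbounded) distinguisher `D` between the real execution, with
`Y`, and the ideal execution, with the silent deletion-requester. -/
noncomputable def advantage {V M : Type*} {C : DataCollector V} (Z : Environment C M)
    (Y : DeletionRequester C M) (D : C.State × Z.View → PMF Bool) : ℝ :=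
  |(((exec Z Y).bind D) true).toReal -
    (((exec Z (DeletionRequester.silent C M)).bind D) true).toReal|

theorem advantage_nonneg {V M : Type*} {C : DataCollector V} (Z : Environment C M)
    (Y : DeletionRequester C M) (D : C.State × Z.View → PMF Bool) : 0 ≤ advantage Z Y D :=
  abs_nonneg _

theorem advantage_le_one {V M : Type*} {C : DataCollector V} (Z : Environment C M)
    (Y : DeletionRequester C M) (D : C.State × Z.View → PMF Bool) : advantage Z Y D ≤ 1 := by
  have h : ∀ p : PMF Bool, (p true).toReal ≤ 1 := fun p =>
    ENNReal.toReal_le_of_le_ofReal zero_le_one (by simpa using p.coe_le_one true)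
  exact abs_sub_le_of_nonneg_of_le ENNReal.toReal_nonneg (h _) ENNReal.toReal_nonneg (h _)

/-- The `k`-representative deletion-compliance error at security parameter `secp`: the supremum of
the advantage over all environments, all `k`-representative deletion-requesters, both of them
polynomially bounded, and all distinguishers. It is the supremum of a nonempty set of numbers in the
unit interval. `M` is the type of messages from environments to deletion-requesters. -/
noncomputable def representativeComplianceError {V : Type*} (C : ℕ → DataCollector V) (M : Type*)
    (k secp : ℕ) : ℝ :=
  sSup {δ : ℝ | ∃ (Z : ∀ n, Environment (C n) M) (Y : ∀ n, DeletionRequester (C n) M)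
    (D : (C secp).State × (Z secp).View → PMF Bool),
      (PolynomiallyBounded fun n => (Z n).budget) ∧
      (PolynomiallyBounded fun n => (Y n).budget) ∧
      (∀ n, (Y n).IsRepresentative k) ∧
      δ = advantage (Z secp) (Y secp) D}

/-! ### History-independent dictionaries -/

inductive DictOp (K V : Type*) where
  | insert (key : K) (value : V)
  | lookup (key : K)
  | delete (key : K)

/-- Results of operations: whether an entry was inserted, the value found, or nothing. -/
inductive DictResult (V : Type*) where
  | inserted (b : Bool)
  | found (value : Option V)
  | null

/-- Effect of an operation on an abstract dictionary, a partial function from keys to values. -/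
def DictOp.apply {K V : Type*} [DecidableEq K] : DictOp K V → (K → Option V) → (K → Option V)
  | .insert k v, d => if (d k).isSome then d else Function.update d k (some v)
  | .lookup _, d => d
  | .delete k, d => Function.update d k none

/-- Result of an operation on an abstract dictionary. -/
def DictOp.result {K V : Type*} : DictOp K V → (K → Option V) → DictResult V
  | .insert k _, d => .inserted (d k).isNone
  | .lookup k, d => .found (d k)
  | .delete _, _ => .null

/-- The dictionary after a sequence of operations. -/
def dictAfter {K V : Type*} [DecidableEq K] : List (DictOp K V) → (K → Option V) → (K → Option V)
  | [], d => d
  | op :: ops, d => dictAfter ops (op.apply d)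

/-- The results returned by a sequence of operations. -/
def dictResults {K V : Type*} [DecidableEq K] :
    List (DictOp K V) → (K → Option V) → List (DictResult V)
  | [], _ => []
  | op :: ops, d => op.result d :: dictResults ops (op.apply d)

/-- Two sequences of operations (on an initially empty dictionary) produce the same content if every
further sequence returns the same results after either of them. -/
def SameContent {K V : Type*} [DecidableEq K] (S₁ S₂ : List (DictOp K V)) : Prop :=
  ∀ T : List (DictOp K V),
    dictResults T (dictAfter S₁ fun _ => none) = dictResults T (dictAfter S₂ fun _ => none)

/-- A (randomized) implementation of dictionaries. `Mem` is the type of memory representations, and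
`content m` is the dictionary that is represented by `m`. -/
structure DictImpl (K V : Type*) [DecidableEq K] where
  Mem : Type*
  empty : PMF Mem
  step : DictOp K V → Mem → PMF Mem
  content : Mem → K → Option V
  content_empty : ∀ m ∈ empty.support, content m = fun _ => none
  content_step : ∀ op m, ∀ m' ∈ (step op m).support, content m' = op.apply (content m)

/-- The memory representation after a sequence of operations, starting from memory `m`. -/
noncomputable def DictImpl.runFrom {K V : Type*} [DecidableEq K] (I : DictImpl K V) :
    List (DictOp K V) → I.Mem → PMF I.Mem
  | [], m => PMF.pure m
  | op :: ops, m => (I.step op m).bind (I.runFrom ops)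

/-- History independence: sequences of operations that produce the same content induce the same
distribution on the memory representation. -/
def DictImpl.HistoryIndependent {K V : Type*} [DecidableEq K] (I : DictImpl K V) : Prop :=
  ∀ S₁ S₂ : List (DictOp K V), SameContent S₁ S₂ →
    I.empty.bind (I.runFrom S₁) = I.empty.bind (I.runFrom S₂)

/-! ### Learning with exact data deletion -/

/-- `delete` is a data deletion operation for `learn`: for every dataset and every index (counted
from `0`), deleting the entry from a learned hypothesis and learning without the entry have the same
output distribution. -/
def IsDataDeletion {V H : Type*} (learn : List V → PMF H) (delete : List V → H → ℕ → PMF H) : Prop :=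
  ∀ (D : List V) (i : ℕ), i < D.length →
    (learn D).bind (fun h => delete D h i) = learn (D.eraseIdx i)

/-- The dataset represented by a dictionary: its values, in increasing order of the keys. -/
def dictRows {n : ℕ} {V : Type*} (d : BitVec n → Option V) : List V :=
  (List.finRange (2 ^ n)).filterMap fun i => d (BitVec.ofFin i)

/-- The index in `dictRows d` of the entry stored under `key`. -/
def dictIndex {n : ℕ} {V : Type*} (d : BitVec n → Option V) (key : BitVec n) : ℕ :=
  ((List.finRange (2 ^ n)).filter fun i => i < key.toFin ∧ (d (BitVec.ofFin i)).isSome).length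

/-! ### The data collector -/

/-- The work tape of the collector; the model `⊥` is `none`. -/
structure MLState (Mem H : Type*) where
  mem : Mem
  thr : ℕ
  count : ℕ
  learnt : Bool
  model : Option H

/-- Processing of a data point: the new state, and the key that is sent back. -/
noncomputable def mlInsert {V H : Type*} {secp : ℕ} (learn : List V → PMF H)
    (I : DictImpl (BitVec secp) V) (v : V) (s : MLState I.Mem H) :
    PMF (MLState I.Mem H × Option (BitVec secp)) :=
  ((PMF.uniformOfFintype (Fin (2 ^ secp))).map BitVec.ofFin).bind fun key =>
    if s.learnt then PMF.pure (s, some key)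
    else
      (I.step (.insert key v) s.mem).bind fun mem =>
        let count := if (I.content s.mem key).isNone then s.count + 1 else s.count
        if count = s.thr then
          (learn (dictRows (I.content mem))).map fun h =>
            ({ mem := mem, thr := s.thr, count := count, learnt := true, model := some h },
              some key)
        else
          PMF.pure ({ s with mem := mem, count := count }, some key)

/-- Processing of a deletion request. -/
noncomputable def mlDelete {V H : Type*} {secp : ℕ} (delete : List V → H → ℕ → PMF H)
    (I : DictImpl (BitVec secp) V) (key : BitVec secp) (s : MLState I.Mem H) :
    PMF (MLState I.Mem H) :=
  (I.step (.lookup key) s.mem).bind fun mem =>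
    if (I.content s.mem key).isSome then
      (match s.model with
        | none => PMF.pure none
        | some h =>
          (delete (dictRows (I.content mem)) h (dictIndex (I.content mem) key)).map some).bind
        fun model =>
          (I.step (.delete key) mem).map fun mem' =>
            { mem := mem'
              thr := if s.learnt then s.thr - 1 else s.thr
              count := s.count - 1
              learnt := s.learnt
              model := model }
    else PMF.pure { s with mem := mem }

/-- The collector that trains a model when the number of stored data points reaches a random
threshold, and updates it on deletion requests. Replies and deletion tokens are the random keys. -/
noncomputable def mlCollector {V H : Type*} (learn : List V → PMF H)
    (delete : List V → H → ℕ → PMF H) (secp : ℕ) (I : DictImpl (BitVec secp) V) :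
    DataCollector V where
  State := MLState I.Mem H
  Reply := BitVec secp
  Token := BitVec secp
  setup :=
    I.empty.bind fun mem =>
      (PMF.uniformOfFinset (Finset.Icc secp (2 * secp))
        ⟨secp, Finset.mem_Icc.mpr ⟨le_rfl, by omega⟩⟩).map fun thr =>
          { mem := mem, thr := thr, count := 0, learnt := false, model := none }
  activate
    | none, s => PMF.pure (s, none)
    | some (.insert v), s => mlInsert learn I v s
    | some (.delete key), s => (mlDelete delete I key s).map fun s' => (s', none)
  token _ key := key

/-! The collector answers every data point with a fresh uniform key, whatever its state. So the
messages exchanged with `Z` have a law of their own (`logDist`), the same in both executions, and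
`Y` is determined by its coins, that log and the one key `k` it receives.

The state of the collector is equally tame. History independence makes the law of the memory a
function of the content, exactness of `delete` makes a trained model distributed as `learn` of the
current content, and after training `thr` and `count` both equal the number of entries, since they
agree at training and fall together. Thus the final state depends in law only on a deterministic
process, `TrainState.run`, driven by the dictionary operations and the initial threshold
(`stateDist_bind_mlInsert`, `stateDist_bind_mlDelete`, `exec_eq`).

Fix the coins and the log. If `Y` starts an instance, the ideal operations are `A ++ B`, and the
real ones are `A`, the insertion of `k`, then `B` interspersed with at least one deletion of `k`
(`allOps_of_nil`). As `A` and `B` do not depend on `k`, a union bound excludes the few keys that the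
ideal dictionary holds at a critical time (`exposedKeys`). For other `k`, let `M` be the largest
size of the untrained ideal dictionary before the insertion, and `m ≥ M` the largest until the
additional entry goes. If `thr ≤ M`, training precedes the insertion, which is then ignored. If `M <
thr ≤ m`, the real process with `thr + 1` trains together with the ideal one with `thr`, and the
additional entry is later erased without trace. If `thr ≥ m + 2`, the entry is gone before training.
Only `m + 1` has no partner (`exists_levels`, `exists_threshold_matching`), and one threshold has
probability `1 / (secp + 1)`. -/

/-! ### The training phase as a deterministic process -/

section Training

variable {K V : Type*} [Fintype K] [DecidableEq K]

/-- The keys in use in a dictionary. -/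
def dictSupport (d : K → Option V) : Finset K := Finset.univ.filter fun k => (d k).isSome

/-- The content of a collector, its model being a function of the content once it is trained; until
then the collector waits for `thr` entries. -/
inductive TrainState (K V : Type*) where
  | training (d : K → Option V) (thr : ℕ)
  | trained (d : K → Option V)

/-- The size is tested after every operation; below the threshold only an effective insertion can
reach it. A trained collector ignores data points. -/
def TrainState.step (op : DictOp K V) : TrainState K V → TrainState K V
  | .training d thr =>
    if (dictSupport (op.apply d)).card = thr then .trained (op.apply d)
    else .training (op.apply d) thr
  | .trained d =>
    match op with
    | .insert _ _ => .trained d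
    | .lookup _ => .trained d
    | .delete k => .trained (Function.update d k none)

def TrainState.run : List (DictOp K V) → TrainState K V → TrainState K V
  | [], x => x
  | op :: ops, x => TrainState.run ops (x.step op)

theorem TrainState.run_append (l₁ l₂ : List (DictOp K V)) (x : TrainState K V) :
    TrainState.run (l₁ ++ l₂) x = TrainState.run l₂ (TrainState.run l₁ x) := by
  induction l₁ generalizing x with
  | nil => rfl
  | cons op l ih => exact ih _

/-- The dictionary when it first has `thr` entries, or at the end. -/
def snapshot (thr : ℕ) : List (DictOp K V) → (K → Option V) → (K → Option V)
  | [], d => d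
  | op :: ops, d =>
    if (dictSupport (op.apply d)).card = thr then op.apply d else snapshot thr ops (op.apply d)

omit [DecidableEq K] in
theorem mem_dictSupport {d : K → Option V} {k : K} : k ∈ dictSupport d ↔ (d k).isSome := by
  simp [dictSupport]

omit [DecidableEq K] in
theorem notMem_dictSupport {d : K → Option V} {k : K} : k ∉ dictSupport d ↔ d k = none := by
  simp [dictSupport]

theorem dictSupport_update_some (d : K → Option V) (k : K) (v : V) :
    dictSupport (Function.update d k (some v)) = insert k (dictSupport d) := by
  ext j
  by_cases h : j = k <;> simp [mem_dictSupport, h]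

theorem dictSupport_update_none (d : K → Option V) (k : K) :
    dictSupport (Function.update d k none) = (dictSupport d).erase k := by
  ext j
  by_cases h : j = k <;> simp [mem_dictSupport, h]

theorem card_dictSupport_apply_le (op : DictOp K V) (d : K → Option V) :
    (dictSupport (op.apply d)).card ≤ (dictSupport d).card + 1 := by
  cases op with
  | insert k v =>
    simp only [DictOp.apply]
    split_ifs
    · omega
    · rw [dictSupport_update_some]; exact Finset.card_insert_le _ _
  | lookup k => simp [DictOp.apply]
  | delete k =>
    rw [DictOp.apply, dictSupport_update_none]
    exact (Finset.card_erase_le).trans (Nat.le_succ _)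

/-- The size grows by at most one per operation, so it cannot jump over `thr`. -/
theorem card_snapshot_le (thr : ℕ) (ops : List (DictOp K V)) (d : K → Option V)
    (h : (dictSupport d).card < thr) : (dictSupport (snapshot thr ops d)).card ≤ thr := by
  induction ops generalizing d with
  | nil => exact h.le
  | cons op ops ih =>
    rw [snapshot]
    split_ifs with h1
    · exact h1.le
    · have := card_dictSupport_apply_le op d
      exact ih _ (by omega)

/-! ### Dictionaries that differ in one entry -/

/-- The dictionaries agree outside of one key. -/
def AgreeOff (k : K) (d d' : K → Option V) : Prop := ∀ j, j ≠ k → d j = d' j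

omit [Fintype K] in
theorem AgreeOff.apply {k : K} {d d' : K → Option V} (h : AgreeOff k d d') (op : DictOp K V) :
    AgreeOff k (op.apply d) (op.apply d') := by
  intro j hj
  have hjj := h j hj
  cases op with
  | insert i v =>
    by_cases hij : i = k
    · subst hij
      simp only [DictOp.apply]
      split_ifs <;> simp [hj, hjj]
    · simp only [DictOp.apply, h i hij]
      split_ifs <;> simp [Function.update_apply, hjj]
  | lookup i => exact hjj
  | delete i => simp [DictOp.apply, Function.update_apply, hjj]

omit [Fintype K] in
theorem AgreeOff.delete_right {k : K} {d d' : K → Option V} (h : AgreeOff k d d') :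
    AgreeOff k d (Function.update d' k none) := by
  intro j hj
  simp [hj, h j hj]

omit [Fintype K] in
theorem AgreeOff.eq {k : K} {d d' : K → Option V} (h : AgreeOff k d d') (hk : d k = d' k) :
    d = d' := by
  funext j
  by_cases hj : j = k
  · rw [hj, hk]
  · exact h j hj

theorem AgreeOff.dictSupport_subset {k : K} {d d' : K → Option V} (h : AgreeOff k d d') :
    dictSupport d' ⊆ insert k (dictSupport d) := by
  intro j hj
  rw [mem_dictSupport] at hj
  by_cases hjk : j = k
  · simp [hjk]
  · rw [← h j hjk] at hj
    exact Finset.mem_insert_of_mem (mem_dictSupport.2 hj)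

theorem AgreeOff.card_le_succ {k : K} {d d' : K → Option V} (h : AgreeOff k d d') :
    (dictSupport d').card ≤ (dictSupport d).card + 1 :=
  (Finset.card_le_card h.dictSupport_subset).trans (Finset.card_insert_le _ _)

theorem AgreeOff.card_le {k : K} {d d' : K → Option V} (h : AgreeOff k d d')
    (hk : (d' k).isSome → (d k).isSome) : (dictSupport d').card ≤ (dictSupport d).card := by
  refine Finset.card_le_card fun j hj => ?_
  rw [mem_dictSupport] at hj ⊢
  by_cases hjk : j = k
  · rw [hjk] at hj ⊢
    exact hk hj
  · rwa [h j hjk]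

theorem AgreeOff.card_eq_succ {k : K} {d d' : K → Option V} (h : AgreeOff k d d')
    (hd : d k = none) (hd' : (d' k).isSome) :
    (dictSupport d').card = (dictSupport d).card + 1 := by
  have : dictSupport d' = insert k (dictSupport d) := by
    refine h.dictSupport_subset.antisymm (Finset.insert_subset (mem_dictSupport.2 hd') ?_)
    intro j hj
    rw [mem_dictSupport] at hj ⊢
    by_cases hjk : j = k
    · rw [hjk]
      exact hd'
    · rwa [← h j hjk]
  rw [this, Finset.card_insert_of_notMem (notMem_dictSupport.2 hd)]

/-! ### Additional deletions of one key

A list `W : List (Option (DictOp K V))` describes two sequences of operations: in one of them, `none`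
stands for a deletion of the key `k`, in the other one it is left out. -/

/-- Once trained, additional deletions of a key that is not in use otherwise have no effect. -/
theorem run_trained_eq {k : K} (W : List (Option (DictOp K V))) (d d' : K → Option V)
    (h : AgreeOff k d d') (hd : d k = none) (hW : none ∈ W ∨ d' k = none) :
    TrainState.run (W.map fun o => o.getD (.delete k)) (.trained d') =
      TrainState.run W.reduceOption (.trained d) := by
  induction W generalizing d d' with
  | nil =>
    have hd' : d' k = none := by simpa using hW
    rw [h.eq (hd.trans hd'.symm)]
    rfl
  | cons w W ih =>
    cases w with
    | none => exact ih _ _ h.delete_right hd (Or.inr (by simp))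
    | some op =>
      have hW' : none ∈ W ∨ d' k = none := by simpa using hW
      cases op with
      -- A trained state ignores insertions, so `k` cannot come back.
      | insert i v => exact ih _ _ h hd hW'
      | lookup i => exact ih _ _ h hd hW'
      | delete i =>
        refine ih _ _ (h.apply (.delete i)) ?_ (hW'.imp_right fun h' => ?_) <;>
        · rw [Function.update_apply]
          split_ifs <;> simp [*]

-- An insertion of `k` leaves `k` in use on both sides, a deletion on neither. This is the invariant
-- of `run_training_eq`.
omit [Fintype K] in
theorem DictOp.isSome_apply_of_imp {k : K} {d d' : K → Option V}
    (hk : (d' k).isSome → (d k).isSome) (op : DictOp K V) :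
    ((op.apply d') k).isSome → ((op.apply d) k).isSome := by
  cases op with
  | insert i v =>
    simp only [DictOp.apply]
    by_cases hi : i = k
    · subst hi
      split_ifs with h1 h2 <;> simp_all
    · have hi' : k ≠ i := fun h => hi h.symm
      split_ifs <;> simpa [Function.update_apply, hi'] using hk
  | lookup i => exact hk
  | delete i =>
    simp only [DictOp.apply, Function.update_apply]
    split_ifs
    · simp
    · exact hk

theorem TrainState.step_training_of_ne {op : DictOp K V} {d : K → Option V} {thr : ℕ}
    (h : (dictSupport (op.apply d)).card ≠ thr) :
    TrainState.step op (.training d thr) = .training (op.apply d) thr := by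
  simp [TrainState.step, h]

theorem TrainState.step_training_of_eq {op : DictOp K V} {d : K → Option V} {thr : ℕ}
    (h : (dictSupport (op.apply d)).card = thr) :
    TrainState.step op (.training d thr) = .trained (op.apply d) := by
  simp [TrainState.step, h]

theorem snapshot_cons_of_ne {op : DictOp K V} {ops : List (DictOp K V)} {d : K → Option V}
    {thr : ℕ} (h : (dictSupport (op.apply d)).card ≠ thr) :
    snapshot thr (op :: ops) d = snapshot thr ops (op.apply d) := by
  simp [snapshot, h]

theorem snapshot_cons_of_eq {op : DictOp K V} {ops : List (DictOp K V)} {d : K → Option V}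
    {thr : ℕ} (h : (dictSupport (op.apply d)).card = thr) :
    snapshot thr (op :: ops) d = op.apply d := by
  simp [snapshot, h]

/-- Additional deletions have no effect when they concern a key that is not in use at the time of
training, and that was not in use in the one dictionary if it was not in use in the other. -/
theorem run_training_eq {k : K} (thr : ℕ) (W : List (Option (DictOp K V))) (d d' : K → Option V)
    (h : AgreeOff k d d') (hk : (d' k).isSome → (d k).isSome) (hd : (dictSupport d).card < thr)
    (hs : snapshot thr W.reduceOption d k = none) :
    TrainState.run (W.map fun o => o.getD (.delete k)) (.training d' thr) =
      TrainState.run W.reduceOption (.training d thr) := by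
  induction W generalizing d d' with
  | nil =>
    -- No training took place: `snapshot` is now the final dictionary, so `hs` excludes an entry
    -- that the environment itself left under `k`.
    have hd0 : d k = none := hs
    have hd' : d' k = none := by simpa [hd0] using hk
    rw [h.eq (hd0.trans hd'.symm)]
    rfl
  | cons w W ih =>
    cases w with
    | none =>
      have hk' : (Function.update d' k none k).isSome → (d k).isSome := by simp
      have hc := h.delete_right.card_le hk'
      -- The second dictionary stays no larger than the first, which is below `thr`.
      have hne : (dictSupport ((DictOp.delete k : DictOp K V).apply d')).card ≠ thr := by
        rw [DictOp.apply]; omega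
      rw [List.map_cons, Option.getD_none, TrainState.run, TrainState.step_training_of_ne hne]
      exact ih _ _ h.delete_right hk' hd hs
    | some op =>
      rw [List.reduceOption_cons_of_some] at hs ⊢
      have hk1 := DictOp.isSome_apply_of_imp hk op
      have h1 := h.apply op
      have hc := h1.card_le hk1
      have hc' := card_dictSupport_apply_le op d
      rw [List.map_cons, Option.getD_some, TrainState.run, TrainState.run]
      by_cases ht : (dictSupport (op.apply d)).card = thr
      · rw [snapshot_cons_of_eq ht] at hs
        -- At training time `k` is missing on the first side, hence on the second; the dictionaries
        -- coincide and train together.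
        have hs' : op.apply d' k = none := by simpa [hs] using hk1
        have heq := h1.eq (hs.trans hs'.symm)
        rw [TrainState.step_training_of_eq ht, TrainState.step_training_of_eq (heq ▸ ht)]
        exact run_trained_eq _ _ _ h1 hs (Or.inr hs')
      · rw [snapshot_cons_of_ne ht] at hs
        rw [TrainState.step_training_of_ne ht, TrainState.step_training_of_ne (by omega)]
        exact ih _ _ h1 hk1 (by omega) hs

/-- The effect of an additional entry that is deleted later: up to some level `m` it is compensated by
an increment of the threshold, and it has no effect above the next level. -/
theorem exists_level_of_present {k : K} (W : List (Option (DictOp K V))) (hW : none ∈ W)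
    (d d' : K → Option V) (h : AgreeOff k d d') (hk : (d' k).isSome) :
    ∃ m, (dictSupport d).card ≤ m ∧ ∀ thr, (dictSupport d).card < thr →
      snapshot thr W.reduceOption d k = none →
      (thr ≤ m → TrainState.run (W.map fun o => o.getD (.delete k)) (.training d' (thr + 1)) =
        TrainState.run W.reduceOption (.training d thr)) ∧
      (m + 2 ≤ thr → TrainState.run (W.map fun o => o.getD (.delete k)) (.training d' thr) =
        TrainState.run W.reduceOption (.training d thr)) := by
  induction W generalizing d d' with
  | nil => simp at hW
  | cons w W ih =>
    cases w with
    | none =>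
      -- The additional entry goes now, so `m` is the current size and no threshold in range is `≤
      -- m`.
      refine ⟨_, le_rfl, fun thr ht hs => ⟨fun ht' => by omega, fun ht' => ?_⟩⟩
      have hk' : (Function.update d' k none k).isSome → (d k).isSome := by simp
      have hc := h.delete_right.card_le hk'
      have hne : (dictSupport ((DictOp.delete k : DictOp K V).apply d')).card ≠ thr := by
        rw [DictOp.apply]; omega
      rw [List.map_cons, Option.getD_none, TrainState.run, TrainState.step_training_of_ne hne]
      exact run_training_eq _ _ _ _ h.delete_right hk' ht hs
    | some op =>
      have hW' : none ∈ W := by simpa using hW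
      have h1 := h.apply op
      have hc := card_dictSupport_apply_le op d
      by_cases hk1 : (op.apply d' k).isSome
      · obtain ⟨m, hm, H⟩ := ih hW' _ _ h1 hk1
        -- `m` is the running maximum of the size of `d` while the additional entry is present.
        refine ⟨max (dictSupport d).card m, le_max_left _ _, fun thr ht hs => ?_⟩
        rw [List.reduceOption_cons_of_some] at hs ⊢
        rw [List.map_cons, Option.getD_some, TrainState.run, TrainState.run, TrainState.run]
        have hc1 := h1.card_le_succ
        by_cases he : (dictSupport (op.apply d)).card = thr
        · refine ⟨fun _ => ?_, fun ht' => by omega⟩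
          rw [snapshot_cons_of_eq he] at hs
          -- The sizes differ by exactly one here, so `thr` and `thr + 1` are reached by the same
          -- operation.
          have hc2 := h1.card_eq_succ hs hk1
          rw [TrainState.step_training_of_eq he, TrainState.step_training_of_eq (by omega)]
          exact run_trained_eq _ _ _ h1 hs (Or.inl hW')
        · rw [snapshot_cons_of_ne he] at hs
          rw [TrainState.step_training_of_ne he]
          obtain ⟨H1, H2⟩ := H thr (by omega) hs
          refine ⟨fun ht' => ?_, fun ht' => ?_⟩
          · rw [TrainState.step_training_of_ne (by omega)]
            exact H1 (by omega)
          -- Source of `m + 2`: the second dictionary has at most one entry more than the first,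
          -- hence at most `m + 1`.
          · rw [TrainState.step_training_of_ne (by omega)]
            exact H2 (by omega)
      -- The environment itself has just deleted `k`, which ends the presence of the additional
      -- entry.
      · refine ⟨_, le_rfl, fun thr ht hs => ⟨fun ht' => by omega, fun ht' => ?_⟩⟩
        rw [List.reduceOption_cons_of_some] at hs ⊢
        have hc1 := h1.card_le (fun h' => absurd h' hk1)
        rw [snapshot_cons_of_ne (by omega)] at hs
        rw [List.map_cons, Option.getD_some, TrainState.run, TrainState.run,
          TrainState.step_training_of_ne (by omega), TrainState.step_training_of_ne (by omega)]
        exact run_training_eq _ _ _ _ h1 (fun h' => absurd h' hk1) (by omega) hs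

theorem TrainState.run_trained_insert (k : K) (u : V) (ops : List (DictOp K V))
    (d : K → Option V) :
    TrainState.run (.insert k u :: ops) (.trained d) = TrainState.run ops (.trained d) := rfl

theorem exists_run_trained_eq (ops : List (DictOp K V)) (d : K → Option V) :
    ∃ d', TrainState.run ops (.trained d) = .trained d' ∧ ∀ k, d k = none → d' k = none := by
  induction ops generalizing d with
  | nil => exact ⟨d, rfl, fun _ h => h⟩
  | cons op ops ih =>
    cases op with
    | insert i v => exact ih d
    | lookup i => exact ih d
    | delete i =>
      obtain ⟨d', h, hk⟩ := ih (Function.update d i none)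
      refine ⟨d', h, fun k hd => hk k ?_⟩
      rw [Function.update_apply]
      split_ifs <;> simp [hd]

/-- Insertion of an additional entry, with later deletions of the same key. -/
theorem exists_levels {k : K} (u : V) (N : ℕ) (A : List (DictOp K V))
    (W : List (Option (DictOp K V))) (hW : none ∈ W) (d : K → Option V)
    (hN : (dictSupport d).card < N) (hA : snapshot N A d k = none) :
    ∃ M m, (dictSupport d).card ≤ M ∧ M ≤ m ∧ ∀ thr, (dictSupport d).card < thr → thr ≤ N →
      snapshot thr (A ++ W.reduceOption) d k = none →
      (thr ≤ M →
        TrainState.run (A ++ .insert k u :: W.map fun o => o.getD (.delete k)) (.training d thr) =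
        TrainState.run (A ++ W.reduceOption) (.training d thr)) ∧
      (M < thr → thr ≤ m →
        TrainState.run (A ++ .insert k u :: W.map fun o => o.getD (.delete k))
          (.training d (thr + 1)) =
        TrainState.run (A ++ W.reduceOption) (.training d thr)) ∧
      (m + 2 ≤ thr →
        TrainState.run (A ++ .insert k u :: W.map fun o => o.getD (.delete k)) (.training d thr) =
        TrainState.run (A ++ W.reduceOption) (.training d thr)) := by
  induction A generalizing d with
  | nil =>
    -- `N` was not reached during `A`, so the snapshot is the dictionary at the time of the
    -- insertion, and `hA` makes this insertion effective.
    have hd : d k = none := hA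
    have hi : (DictOp.insert k u : DictOp K V).apply d = Function.update d k (some u) := by
      simp [DictOp.apply, hd]
    have h : AgreeOff k d (Function.update d k (some u)) := fun j hj => by simp [hj]
    have hc := h.card_eq_succ hd (by simp)
    obtain ⟨m, hm, H⟩ := exists_level_of_present W hW d _ h (by simp)
    refine ⟨_, m, le_rfl, hm, fun thr ht _ hs => ?_⟩
    obtain ⟨H1, H2⟩ := H thr ht hs
    refine ⟨fun ht' => by omega, fun _ ht' => ?_, fun ht' => ?_⟩
    · rw [List.nil_append, TrainState.run, TrainState.step_training_of_ne (by rw [hi]; omega), hi]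
      exact H1 ht'
    · rw [List.nil_append, TrainState.run, TrainState.step_training_of_ne (by rw [hi]; omega), hi]
      exact H2 ht'
  | cons op A ih =>
    have hc := card_dictSupport_apply_le op d
    -- Training before the insertion: the trained state ignores it, and the deletions of `k` find no
    -- entry.
    have key : ∀ thr, (dictSupport (op.apply d)).card = thr →
        snapshot thr (op :: A ++ W.reduceOption) d k = none →
        TrainState.run (op :: A ++ .insert k u :: W.map fun o => o.getD (.delete k))
          (.training d thr) =
        TrainState.run (op :: A ++ W.reduceOption) (.training d thr) := by
      intro thr he hs
      rw [List.cons_append, snapshot_cons_of_eq he] at hs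
      rw [List.cons_append, List.cons_append, TrainState.run, TrainState.run,
        TrainState.step_training_of_eq he]
      obtain ⟨d₂, h₂, hk₂⟩ := exists_run_trained_eq A (op.apply d)
      rw [TrainState.run_append, TrainState.run_append, h₂, TrainState.run_trained_insert]
      exact run_trained_eq W _ _ (fun _ _ => rfl) (hk₂ k hs) (Or.inl hW)
    by_cases heN : (dictSupport (op.apply d)).card = N
    -- One operation adds at most one entry, so `thr = N` is the only threshold still in range, and
    -- it trains now.
    · refine ⟨N, N, hN.le, le_rfl, fun thr ht htN hs => ⟨fun _ => ?_, fun h => by omega,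
        fun h => by omega⟩⟩
      exact key thr (by omega) hs
    · rw [snapshot_cons_of_ne heN] at hA
      obtain ⟨M, m, h1, h2, H⟩ := ih _ (by omega) hA
      -- The maximum preserves the lower bound through deletions; it is harmless because thresholds
      -- in range exceed the current size.
      refine ⟨max (dictSupport d).card M, max (dictSupport d).card m, le_max_left _ _,
        max_le_max le_rfl h2, fun thr ht htN hs => ?_⟩
      by_cases he : (dictSupport (op.apply d)).card = thr
      · exact ⟨fun _ => key thr he hs, fun h => by omega, fun h => by omega⟩
      · rw [List.cons_append, snapshot_cons_of_ne he] at hs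
        obtain ⟨H1, H2, H3⟩ := H thr (by omega) htN hs
        simp only [List.cons_append, TrainState.run]
        refine ⟨fun h => ?_, fun h h' => ?_, fun h => ?_⟩
        · rw [TrainState.step_training_of_ne he]
          exact H1 (by omega)
        · rw [TrainState.step_training_of_ne he, TrainState.step_training_of_ne (by omega)]
          exact H2 (by omega) (by omega)
        · rw [TrainState.step_training_of_ne he]
          exact H3 (by omega)

/-! ### Exposed keys and the matching of thresholds -/

/-- The keys that occur at the times of training. -/
def exposedKeys (N : ℕ) (A B : List (DictOp K V)) : Finset K :=
  ((Finset.Icc N (2 * N)).biUnion fun thr =>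
    dictSupport (snapshot thr (A ++ B) fun _ => none)) ∪
    dictSupport (snapshot (2 * N) A fun _ => none)

omit [DecidableEq K] in
theorem dictSupport_empty : dictSupport (fun _ : K => (none : Option V)) = ∅ := by
  simp [dictSupport]

/-- There are `N + 1` thresholds and one further snapshot, of `A` alone, each with at most `2 * N`
keys. -/
theorem card_exposedKeys_le (N : ℕ) (hN : 1 ≤ N) (A B : List (DictOp K V)) :
    (exposedKeys N A B).card ≤ (N + 2) * (2 * N) := by
  have h : ∀ thr, N ≤ thr → thr ≤ 2 * N → ∀ ops : List (DictOp K V),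
      (dictSupport (snapshot thr ops fun _ => none)).card ≤ 2 * N := fun thr h1 h2 ops =>
    (card_snapshot_le thr ops _ (by rw [dictSupport_empty, Finset.card_empty]; omega)).trans h2
  calc (exposedKeys N A B).card
      ≤ (N + 1) * (2 * N) + 2 * N := by
        refine (Finset.card_union_le _ _).trans (add_le_add ?_ (h _ (by omega) le_rfl _))
        refine (Finset.card_biUnion_le_card_mul _ _ (2 * N) fun thr ht => ?_).trans ?_
        · exact h _ (Finset.mem_Icc.1 ht).1 (Finset.mem_Icc.1 ht).2 _
        · rw [Nat.card_Icc]
          exact Nat.mul_le_mul_right _ (by omega)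
    _ = (N + 2) * (2 * N) := by ring

/-- Unless the key `k` is exposed, all thresholds but one can be matched. -/
theorem exists_threshold_matching {k : K} (u : V) (N : ℕ) (hN : 1 ≤ N) (A : List (DictOp K V))
    (W : List (Option (DictOp K V))) (hW : none ∈ W)
    (hk : k ∉ exposedKeys N A W.reduceOption) :
    ∃ e ∈ Finset.Icc N (2 * N), ∃ g : ℕ → ℕ,
      Set.InjOn g ((Finset.Icc N (2 * N)).erase e) ∧
      ∀ thr ∈ (Finset.Icc N (2 * N)).erase e, g thr ∈ Finset.Icc N (2 * N) ∧
        TrainState.run (A ++ .insert k u :: W.map fun o => o.getD (.delete k))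
          (.training (fun _ => none) (g thr)) =
        TrainState.run (A ++ W.reduceOption) (.training (fun _ => none) thr) := by
  simp only [exposedKeys, Finset.mem_union, Finset.mem_biUnion, not_or, not_exists, not_and,
    notMem_dictSupport] at hk
  have h0 : (dictSupport (fun _ : K => (none : Option V))).card = 0 := by
    rw [dictSupport_empty, Finset.card_empty]
  -- `hk.2` concerns the snapshot of `A` alone: `k` is unused when inserted, unless the largest
  -- threshold was reached before.
  obtain ⟨M, m, -, hMm, H⟩ := exists_levels u (2 * N) A W hW (fun _ => none) (by omega) hk.2
  -- The unmatched threshold is `m + 1`, clamped to the range. If `m ≥ 2 * N`, omitting `2 * N`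
  -- keeps the shifted thresholds in range; if `m + 1 < N`, nothing is shifted.
  refine ⟨max N (min (m + 1) (2 * N)), Finset.mem_Icc.2 (by omega),
    fun thr => if M < thr ∧ thr ≤ m then thr + 1 else thr, ?_, fun thr ht => ?_⟩
  · intro a ha b hb hab
    simp only [Finset.coe_erase, Set.mem_sdiff, Finset.mem_coe, Finset.mem_Icc,
      Set.mem_singleton_iff] at ha hb hab
    split_ifs at hab <;> omega
  · rw [Finset.mem_erase] at ht
    have ht2 := Finset.mem_Icc.1 ht.2
    obtain ⟨H1, H2, H3⟩ := H thr (by omega) ht2.2 (hk.1 thr ht.2)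
    beta_reduce
    split_ifs with hc
    · exact ⟨Finset.mem_Icc.2 (by omega), H2 hc.1 hc.2⟩
    · refine ⟨ht.2, ?_⟩
      by_cases h1 : thr ≤ M
      · exact H1 h1
      · exact H3 (by omega)

end Training

/-! ### The distribution of the state of the collector -/

theorem PMF.bind_congr_of_support {α β : Type*} {p : PMF α} {f g : α → PMF β}
    (h : ∀ a ∈ p.support, f a = g a) : p.bind f = p.bind g := by
  ext b
  rw [PMF.bind_apply, PMF.bind_apply]
  refine tsum_congr fun a => ?_
  by_cases ha : a ∈ p.support
  · rw [h a ha]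
  · rw [(PMF.apply_eq_zero_iff p a).2 ha, zero_mul, zero_mul]

/-! ### Datasets and the erasure of one row -/

section Rows

variable {n : ℕ} {V : Type*}

theorem finRange_split {N : ℕ} (i : Fin N) : ∃ l₁ l₂, List.finRange N = l₁ ++ i :: l₂ ∧
    (∀ j ∈ l₁, j < i) ∧ ∀ j ∈ l₂, i < j := by
  obtain ⟨l₁, l₂, h⟩ := List.append_of_mem (List.mem_finRange i)
  have hp := List.pairwise_lt_finRange N
  rw [h, List.pairwise_append, List.pairwise_cons] at hp
  exact ⟨l₁, l₂, h, fun j hj => hp.2.2 j hj i (by simp), hp.2.1.1⟩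

theorem length_filter_isSome {α β : Type*} (f : α → Option β) (l : List α) :
    (l.filter fun a => (f a).isSome).length = (l.filterMap f).length := by
  induction l with
  | nil => rfl
  | cons a l ih => cases h : f a <;> simp [h, ih]

/-- The list of all keys is increasing, so the keys before `key` in it are the smaller ones, whose
entries `dictIndex` counts. -/
theorem dictRows_split (d : BitVec n → Option V) (key : BitVec n) (v : V) (hv : d key = some v) :
    ∃ r₁ r₂, dictRows d = r₁ ++ v :: r₂ ∧ dictIndex d key = r₁.length ∧
      dictRows (Function.update d key none) = r₁ ++ r₂ := by
  obtain ⟨l₁, l₂, h, h₁, h₂⟩ := finRange_split key.toFin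
  have hne : ∀ j : Fin (2 ^ n), j ≠ key.toFin → BitVec.ofFin j ≠ key := fun j hj hk =>
    hj (congrArg BitVec.toFin hk)
  refine ⟨l₁.filterMap fun i => d (BitVec.ofFin i), l₂.filterMap fun i => d (BitVec.ofFin i),
    ?_, ?_, ?_⟩
  · rw [dictRows, h, List.filterMap_append, List.filterMap_cons]
    simp [hv]
  · rw [dictIndex, h, List.filter_append, List.length_append, ← length_filter_isSome]
    have e₁ : (l₁.filter fun i => i < key.toFin ∧ (d (BitVec.ofFin i)).isSome) =
        l₁.filter fun i => (d (BitVec.ofFin i)).isSome :=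
      List.filter_congr fun j hj => by simp [h₁ j hj]
    have e₂ : ((key.toFin :: l₂).filter fun i => i < key.toFin ∧ (d (BitVec.ofFin i)).isSome) =
        [] := by
      rw [List.filter_eq_nil_iff]
      intro j hj
      rcases List.mem_cons.1 hj with rfl | hj
      · simp
      · simp [(h₂ j hj).le]
    rw [e₁, e₂, List.length_nil, add_zero]
  · rw [dictRows, h, List.filterMap_append, List.filterMap_cons]
    have e : ∀ l : List (Fin (2 ^ n)), (∀ j ∈ l, j ≠ key.toFin) →
        (l.filterMap fun i => Function.update d key none (BitVec.ofFin i)) =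
          l.filterMap fun i => d (BitVec.ofFin i) := fun l hl =>
      List.filterMap_congr fun j hj => by simp [hne j (hl j hj)]
    rw [e l₁ fun j hj => (h₁ j hj).ne, e l₂ fun j hj => (h₂ j hj).ne']
    simp

theorem dictIndex_lt_length {d : BitVec n → Option V} {key : BitVec n} {v : V}
    (hv : d key = some v) : dictIndex d key < (dictRows d).length := by
  obtain ⟨r₁, r₂, h, hi, -⟩ := dictRows_split d key v hv
  rw [hi, h, List.length_append, List.length_cons]
  omega

theorem dictRows_eraseIdx {d : BitVec n → Option V} {key : BitVec n} {v : V}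
    (hv : d key = some v) :
    (dictRows d).eraseIdx (dictIndex d key) = dictRows (Function.update d key none) := by
  obtain ⟨r₁, r₂, h, hi, h'⟩ := dictRows_split d key v hv
  rw [hi, h, h', List.eraseIdx_append_of_length_le le_rfl]
  simp

end Rows

/-! ### History independence: one memory distribution per content -/

section MemoryDistribution

variable {K V : Type*} [DecidableEq K]

theorem dictAfter_append (S T : List (DictOp K V)) (d : K → Option V) :
    dictAfter (S ++ T) d = dictAfter T (dictAfter S d) := by
  induction S generalizing d with
  | nil => rfl
  | cons op S ih => exact ih _

/-- Inserting the entries one by one gives every content a history, from which `DictImpl.memDist` is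
defined. -/
theorem exists_dictAfter_eq [Fintype K] (d : K → Option V) :
    ∃ S : List (DictOp K V), dictAfter S (fun _ => none) = d := by
  have key : ∀ s : Finset K, ∀ d : K → Option V, dictSupport d = s →
      ∃ S : List (DictOp K V), dictAfter S (fun _ => none) = d := by
    intro s
    induction s using Finset.induction_on with
    | empty =>
      intro d hd
      refine ⟨[], funext fun k => ?_⟩
      exact (notMem_dictSupport.1 (by simp [hd])).symm
    | insert k s hk ih =>
      intro d hd
      obtain ⟨S, hS⟩ := ih (Function.update d k none) (by
        rw [dictSupport_update_none, hd, Finset.erase_insert hk])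
      obtain ⟨v, hv⟩ := Option.isSome_iff_exists.1 (mem_dictSupport.1 (show k ∈ dictSupport d by
        simp [hd]))
      refine ⟨S ++ [.insert k v], ?_⟩
      rw [dictAfter_append, hS]
      funext j
      by_cases hj : j = k
      · subst hj
        simp [dictAfter, DictOp.apply, hv]
      · simp [dictAfter, DictOp.apply, hj]
  exact key _ d rfl

theorem DictImpl.runFrom_append (I : DictImpl K V) (S T : List (DictOp K V)) (m : I.Mem) :
    I.runFrom (S ++ T) m = (I.runFrom S m).bind (I.runFrom T) := by
  induction S generalizing m with
  | nil => simp [DictImpl.runFrom]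
  | cons op S ih =>
    simp only [List.cons_append, DictImpl.runFrom, PMF.bind_bind]
    exact congrArg _ (funext ih)

theorem DictImpl.content_of_mem_support_runFrom (I : DictImpl K V) (S : List (DictOp K V))
    (m : I.Mem) : ∀ m' ∈ (I.runFrom S m).support, I.content m' = dictAfter S (I.content m) := by
  induction S generalizing m with
  | nil =>
    intro m' hm'
    rw [DictImpl.runFrom, PMF.mem_support_pure_iff] at hm'
    rw [hm']
    rfl
  | cons op S ih =>
    intro m' hm'
    rw [DictImpl.runFrom, PMF.mem_support_bind_iff] at hm'
    obtain ⟨m₁, h₁, h₂⟩ := hm'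
    rw [ih m₁ m' h₂, I.content_step op m m₁ h₁]
    rfl

variable [Fintype K]

/-- The distribution of the memory of a history-independent dictionary, for a given content. -/
noncomputable def DictImpl.memDist (I : DictImpl K V) (d : K → Option V) : PMF I.Mem :=
  I.empty.bind (I.runFrom (exists_dictAfter_eq d).choose)

theorem DictImpl.HistoryIndependent.empty_bind_runFrom {I : DictImpl K V}
    (hI : I.HistoryIndependent) (S : List (DictOp K V)) :
    I.empty.bind (I.runFrom S) = I.memDist (dictAfter S fun _ => none) :=
  hI _ _ fun T => by rw [(exists_dictAfter_eq (dictAfter S fun _ => none)).choose_spec]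

theorem DictImpl.HistoryIndependent.memDist_empty {I : DictImpl K V}
    (hI : I.HistoryIndependent) : I.memDist (fun _ => none) = I.empty := by
  rw [← PMF.bind_pure I.empty]
  exact (hI.empty_bind_runFrom []).symm

/-- Any history of `d` may represent it, and extended by `op` it is a history of the new content. -/
theorem DictImpl.HistoryIndependent.memDist_bind_step {I : DictImpl K V}
    (hI : I.HistoryIndependent) (op : DictOp K V) (d : K → Option V) :
    (I.memDist d).bind (I.step op) = I.memDist (op.apply d) := by
  obtain ⟨S, rfl⟩ := exists_dictAfter_eq d
  have h := hI.empty_bind_runFrom (S ++ [op])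
  rw [dictAfter_append] at h
  rw [← hI.empty_bind_runFrom S, PMF.bind_bind]
  refine Eq.trans ?_ h
  congr 1
  funext m
  rw [I.runFrom_append]
  simp [DictImpl.runFrom]

theorem DictImpl.content_of_mem_support_memDist (I : DictImpl K V) (d : K → Option V) :
    ∀ m ∈ (I.memDist d).support, I.content m = d := by
  intro m hm
  rw [DictImpl.memDist, PMF.mem_support_bind_iff] at hm
  obtain ⟨m₀, h₀, h₁⟩ := hm
  rw [I.content_of_mem_support_runFrom _ _ _ h₁, I.content_empty _ h₀]
  exact (exists_dictAfter_eq d).choose_spec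

end MemoryDistribution

/-! ### The law of the collector's state follows the training process -/

section StateDistribution

variable {V H : Type*} {secp : ℕ} (learn : List V → PMF H) (delete : List V → H → ℕ → PMF H)
  (I : DictImpl (BitVec secp) V)

def TrainState.content {K V : Type*} : TrainState K V → K → Option V
  | .training d _ => d
  | .trained d => d

/-- The distribution of the work tape of the collector, given the memory of the dictionary. -/
noncomputable def stateGivenMem {Mem : Type*} :
    TrainState (BitVec secp) V → Mem → PMF (MLState Mem H)
  | .training d thr, m => PMF.pure
      { mem := m, thr := thr, count := (dictSupport d).card, learnt := false, model := none }
  | .trained d, m => (learn (dictRows d)).map fun h =>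
      { mem := m, thr := (dictSupport d).card, count := (dictSupport d).card, learnt := true,
        model := some h }

/-- The distribution of the work tape of the collector. -/
noncomputable def stateDist (x : TrainState (BitVec secp) V) : PMF (MLState I.Mem H) :=
  (I.memDist x.content).bind (stateGivenMem learn x)

/-- As long as there is no model, there are fewer entries than required. -/
def TrainState.Valid {K V : Type*} [Fintype K] : TrainState K V → Prop
  | .training d thr => (dictSupport d).card < thr
  | .trained _ => True

theorem TrainState.Valid.step {K V : Type*} [Fintype K] [DecidableEq K] {x : TrainState K V}
    (hx : x.Valid) (op : DictOp K V) : (x.step op).Valid := by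
  cases x with
  | training d thr =>
    have h := card_dictSupport_apply_le op d
    have hx' : (dictSupport d).card < thr := hx
    rw [TrainState.step]
    split_ifs
    · trivial
    · change (dictSupport (op.apply d)).card < thr
      omega
  | trained d => cases op <;> trivial

theorem TrainState.Valid.run {K V : Type*} [Fintype K] [DecidableEq K] {x : TrainState K V}
    (hx : x.Valid) (ops : List (DictOp K V)) : (TrainState.run ops x).Valid := by
  induction ops generalizing x with
  | nil => exact hx
  | cons op ops ih => exact ih (hx.step op)

noncomputable def keyDist (secp : ℕ) : PMF (BitVec secp) :=
  (PMF.uniformOfFintype (Fin (2 ^ secp))).map BitVec.ofFin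

variable {I}

/-- The key is drawn independently of the state, so the reply reveals nothing about it. -/
theorem stateDist_bind_mlInsert (hI : I.HistoryIndependent) (v : V)
    (x : TrainState (BitVec secp) V) (hx : x.Valid) :
    (stateDist learn I x).bind (mlInsert learn I v) =
      (keyDist secp).bind fun key =>
        (stateDist learn I (x.step (.insert key v))).map fun s => (s, some key) := by
  unfold mlInsert
  rw [PMF.bind_comm]
  refine congrArg (PMF.bind (keyDist secp)) (funext fun key => ?_)
  rw [stateDist, stateDist, PMF.bind_bind, PMF.map_bind]
  cases x with
  | trained d =>
    refine congrArg _ (funext fun m => ?_)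
    rw [stateGivenMem, PMF.bind_map]
    rw [TrainState.step, stateGivenMem, PMF.map_comp]
    rfl
  | training d thr =>
    have hc : (dictSupport ((DictOp.insert key v : DictOp _ V).apply d)).card =
        if (d key).isNone then (dictSupport d).card + 1 else (dictSupport d).card := by
      cases h : d key with
      | none =>
        simp only [DictOp.apply, h]
        simp [dictSupport_update_some,
          Finset.card_insert_of_notMem (notMem_dictSupport.2 h)]
      | some w => simp [DictOp.apply, h]
    have hcont : (TrainState.step (.insert key v) (.training d thr)).content =
        (DictOp.insert key v).apply d := by
      rw [TrainState.step]
      split_ifs <;> rfl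
    rw [hcont, ← hI.memDist_bind_step, PMF.bind_bind]
    refine PMF.bind_congr_of_support fun m hm => ?_
    have hm' : I.content m = d := I.content_of_mem_support_memDist d m hm
    rw [stateGivenMem, PMF.pure_bind]
    simp only [Bool.false_eq_true, if_false]
    refine PMF.bind_congr_of_support fun mem hmem => ?_
    rw [I.content_step _ _ _ hmem, hm', ← hc, TrainState.step]
    split_ifs with h
    · rw [stateGivenMem, PMF.map_comp, h]
      rfl
    · rw [stateGivenMem, PMF.pure_map]

variable {learn delete}

/-- Exact deletion carries the law of a trained model to that of `learn` on the remaining rows; the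
memory only matters through its content. -/
theorem stateDist_bind_mlDelete (hdelete : IsDataDeletion learn delete)
    (hI : I.HistoryIndependent) (key : BitVec secp) (x : TrainState (BitVec secp) V)
    (hx : x.Valid) :
    (stateDist learn I x).bind (mlDelete delete I key) =
      stateDist learn I (x.step (.delete key)) := by
  have hlook : ∀ d : BitVec secp → Option V,
      (I.memDist d).bind (I.step (.lookup key)) = I.memDist d := fun d =>
    hI.memDist_bind_step (.lookup key) d
  have hcard : ∀ d : BitVec secp → Option V, (d key).isSome →
      (dictSupport (Function.update d key none)).card = (dictSupport d).card - 1 := fun d h => by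
    rw [dictSupport_update_none, Finset.card_erase_of_mem (mem_dictSupport.2 h)]
  have hupd : ∀ d : BitVec secp → Option V, ¬ (d key).isSome → Function.update d key none = d :=
    fun d h => by rw [← Option.not_isSome_iff_eq_none.1 h, Function.update_eq_self]
  cases x with
  | training d thr =>
    have hx' : (dictSupport d).card < thr := hx
    have hstep : TrainState.step (.delete key) (.training d thr) =
        .training (Function.update d key none) thr := by
      refine TrainState.step_training_of_ne ?_
      have := Finset.card_le_card (Finset.erase_subset key (dictSupport d))
      rw [DictOp.apply, dictSupport_update_none]
      omega
    rw [hstep, stateDist, stateDist, PMF.bind_bind]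
    simp only [TrainState.content]
    by_cases hk : (d key).isSome
    · rw [← show I.memDist ((DictOp.delete key).apply d) =
        I.memDist (Function.update d key none) from rfl, ← hI.memDist_bind_step, PMF.bind_bind]
      -- The lookup preserves the memory law, so it may be added on the right to align both sides.
      conv_rhs => rw [← hlook d, PMF.bind_bind]
      refine PMF.bind_congr_of_support fun m hm => ?_
      have hm' := I.content_of_mem_support_memDist d m hm
      simp [stateGivenMem, mlDelete, hm', hk, PMF.map, Function.comp_def]
      refine congrArg _ (funext fun mem => congrArg _ (funext fun mem' => ?_))
      rw [stateGivenMem, hcard d hk]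
    · rw [hupd d hk]
      conv_rhs => rw [← hlook d, PMF.bind_bind]
      refine PMF.bind_congr_of_support fun m hm => ?_
      have hm' := I.content_of_mem_support_memDist d m hm
      simp [stateGivenMem, mlDelete, hm', hk]
      rfl
  | trained d =>
    rw [TrainState.step, stateDist, stateDist, PMF.bind_bind]
    simp only [TrainState.content]
    by_cases hk : (d key).isSome
    · obtain ⟨v, hv⟩ := Option.isSome_iff_exists.1 hk
      rw [← show I.memDist ((DictOp.delete key).apply d) =
        I.memDist (Function.update d key none) from rfl, ← hI.memDist_bind_step, PMF.bind_bind]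
      conv_rhs => rw [← hlook d, PMF.bind_bind]
      refine PMF.bind_congr_of_support fun m hm => ?_
      have hm' := I.content_of_mem_support_memDist d m hm
      have hstep : ∀ h : H, (mlDelete delete I key
          { mem := m, thr := (dictSupport d).card, count := (dictSupport d).card, learnt := true,
            model := some h }) =
          (I.step (.lookup key) m).bind fun mem =>
            (I.step (.delete key) mem).bind fun mem' =>
              (delete (dictRows d) h (dictIndex d key)).map fun h' =>
                { mem := mem', thr := (dictSupport d).card - 1, count := (dictSupport d).card - 1,
                  learnt := true, model := some h' } := by
        intro h
        rw [mlDelete]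
        refine PMF.bind_congr_of_support fun mem hmem => ?_
        have : I.content mem = d := by rw [I.content_step _ _ _ hmem, hm']; rfl
        simp only [this, hm', hk, PMF.bind_map, if_true]
        -- The model update and the deletion from memory use independent coins.
        exact PMF.bind_comm _ _ _
      simp only [stateGivenMem, PMF.bind_map, Function.comp_def, hstep]
      rw [PMF.bind_comm]
      refine congrArg _ (funext fun mem => ?_)
      rw [PMF.bind_comm]
      refine congrArg _ (funext fun mem' => ?_)
      rw [← PMF.map_bind, hdelete _ _ (dictIndex_lt_length hv), dictRows_eraseIdx hv, stateGivenMem, hcard d hk]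
    · rw [hupd d hk]
      conv_rhs => rw [← hlook d, PMF.bind_bind]
      refine PMF.bind_congr_of_support fun m hm => ?_
      have hm' := I.content_of_mem_support_memDist d m hm
      simp only [stateGivenMem, PMF.bind_map, mlDelete, Function.comp_def, hm', hk]
      rw [PMF.bind_comm]
      refine congrArg _ (funext fun mem => ?_)
      rfl

end StateDistribution

/-! ### The instances initiated by a deletion-requester -/

section Instances

variable {V M : Type*} {C : DataCollector V}

theorem DeletionRequester.length_le_of_mem_support_run (Y : DeletionRequester C M) (ρ : Y.Rand)
    (n : ℕ) (y : RequesterState C M) (s : C.State) :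
    ∀ o ∈ (Y.run ρ n y s).support, y.instances.length ≤ o.1.instances.length := by
  induction n generalizing y s with
  | zero =>
    intro o ho
    rw [DeletionRequester.run, PMF.mem_support_pure_iff] at ho
    rw [ho]
  | succ n ih =>
    intro o ho
    rw [DeletionRequester.run] at ho
    split at ho
    · rw [PMF.mem_support_pure_iff] at ho
      rw [ho]
    · rw [PMF.mem_support_bind_iff] at ho
      obtain ⟨⟨s', r⟩, -, ho⟩ := ho
      cases r with
      | none =>
        rw [PMF.mem_support_pure_iff] at ho
        simp [ho]
      | some r =>
        refine le_trans ?_ (ih _ _ o ho)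
        simp
    · split at ho
      · rw [PMF.mem_support_bind_iff] at ho
        obtain ⟨⟨s', r⟩, -, ho⟩ := ho
        cases r with
        | none =>
          rw [PMF.mem_support_pure_iff] at ho
          simp [ho]
        | some r =>
          refine le_trans ?_ (ih _ _ o ho)
          simp
      · rw [PMF.mem_support_pure_iff] at ho
        rw [ho]

/-- `R` is generic to cover both the growth of the number of instances and, for the silent
requester, their constancy. -/
theorem envStep_support {Y : DeletionRequester C M} {ρ : Y.Rand}
    {R : List (Option C.Token × Bool) → List (Option C.Token × Bool) → Prop} (hrefl : ∀ l, R l l)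
    (hrun : ∀ n y s, ∀ o ∈ (Y.run ρ n y s).support, R y.instances o.1.instances)
    (a : EnvAction V C.Token M) (c : Config C M) :
    ∀ c' ∈ (envStep Y ρ a c).support, R c.requester.instances c'.requester.instances := by
  intro c' hc'
  cases a <;> simp only [envStep, PMF.mem_support_pure_iff, PMF.mem_support_map_iff] at hc'
  case message m =>
    obtain ⟨o, ho, rfl⟩ := hc'
    exact hrun Y.budget ⟨c.requester.log ++ [.activated (some m)], c.requester.instances⟩ c.collector o ho
  case activateRequester =>
    obtain ⟨o, ho, rfl⟩ := hc'
    exact hrun Y.budget ⟨c.requester.log ++ [.activated none], c.requester.instances⟩ c.collector o ho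
  case finish =>
    rw [hc']
    exact hrefl _
  all_goals
    obtain ⟨o, ho, rfl⟩ := hc'
    exact hrefl _

theorem alivePhase_support {Z : Environment C M} {Y : DeletionRequester C M} {ρZ : Z.Rand}
    {ρ : Y.Rand} {R : List (Option C.Token × Bool) → List (Option C.Token × Bool) → Prop}
    (hrefl : ∀ l, R l l) (htrans : ∀ l₁ l₂ l₃, R l₁ l₂ → R l₂ l₃ → R l₁ l₃)
    (hrun : ∀ n y s, ∀ o ∈ (Y.run ρ n y s).support, R y.instances o.1.instances)
    (n : ℕ) (c : Config C M) :
    ∀ c' ∈ (alivePhase Z Y ρZ ρ n c).support, R c.requester.instances c'.requester.instances := by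
  induction n generalizing c with
  | zero =>
    intro c' hc'
    rw [alivePhase, PMF.mem_support_pure_iff] at hc'
    rw [hc']
    exact hrefl _
  | succ n ih =>
    intro c' hc'
    rw [alivePhase] at hc'
    split at hc'
    · exact envStep_support hrefl hrun _ _ _ hc'
    · rw [PMF.mem_support_bind_iff] at hc'
      obtain ⟨c₁, h₁, h₂⟩ := hc'
      exact htrans _ _ _ (envStep_support hrefl hrun _ _ _ h₁) (ih _ _ h₂)

theorem DeletionRequester.run_silent (ρ : (DeletionRequester.silent C M).Rand) (n : ℕ)
    (y : RequesterState C M) (s : C.State) :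
    (DeletionRequester.silent C M).run ρ n y s = PMF.pure (y, s) := by
  cases n <;> rfl

end Instances

/-! ### Executions with the collector -/

section Execution

variable {V H M : Type*} {learn : List V → PMF H} {delete : List V → H → ℕ → PMF H} {secp : ℕ}
  {I : DictImpl (BitVec secp) V}

variable (learn delete I) in
/-- The distribution of the state of the collector. -/
noncomputable def collectorDist (x : TrainState (BitVec secp) V) :
    PMF (mlCollector learn delete secp I).State :=
  stateDist learn I x

/-- The deletion-requester after an instance of `π` with reply `k`. -/
def RequesterState.receive (y : RequesterState (mlCollector learn delete secp I) M)
    (k : BitVec secp) : RequesterState (mlCollector learn delete secp I) M :=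
  ⟨y.log ++ [.reply k],
    y.instances ++ [((some k : Option (mlCollector learn delete secp I).Token), false)]⟩

theorem RequesterState.length_receive (y : RequesterState (mlCollector learn delete secp I) M)
    (k : BitVec secp) : (y.receive k).instances.length = y.instances.length + 1 :=
  List.length_append

theorem RequesterState.receive_ne_nil (y : RequesterState (mlCollector learn delete secp I) M)
    (k : BitVec secp) : (y.receive k).instances ≠ [] :=
  List.ne_nil_of_length_pos (by rw [y.length_receive]; omega)

/-- A run of the deletion-requester, when all replies are the key `k`, and its operations on the
dictionary. It is stopped before a second instance of `π`. -/
def requesterRun (Y : DeletionRequester (mlCollector learn delete secp I) M) (ρ : Y.Rand)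
    (k : BitVec secp) : ℕ → RequesterState (mlCollector learn delete secp I) M →
      RequesterState (mlCollector learn delete secp I) M × List (DictOp (BitVec secp) V)
  | 0, y => (y, [])
  | n + 1, y =>
    match Y.act ρ y.log with
    | .halt => (y, [])
    | .collect v =>
      if y.instances.isEmpty then
        let o := requesterRun Y ρ k n (y.receive k)
        (o.1, .insert k v :: o.2)
      else (y, [])
    | .delete j =>
      match y.instances[j]? with
      | some (some t, _) => ({ y with instances := y.instances.set j (some t, true) }, [.delete t])
      | _ => (y, [])

/-- The operations on the dictionary that the environment causes. -/
def logOps : EnvLog (mlCollector learn delete secp I) M → List (DictOp (BitVec secp) V)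
  | [] => []
  | (.collect v, some key) :: L => .insert key v :: logOps L
  | (.delete key, _) :: L => .delete key :: logOps L
  | _ :: L => logOps L

/-- The deletion-requester at the end of the alive phase with the given messages from and to the
environment, and all operations on the dictionary. -/
def requesterAlive (Y : DeletionRequester (mlCollector learn delete secp I) M) (ρ : Y.Rand)
    (k : BitVec secp) : EnvLog (mlCollector learn delete secp I) M →
      RequesterState (mlCollector learn delete secp I) M →
      RequesterState (mlCollector learn delete secp I) M × List (DictOp (BitVec secp) V)
  | [], y => (y, [])
  | (a, r) :: L, y =>
    let activate (m : Option M) :=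
      let o := requesterRun Y ρ k Y.budget { y with log := y.log ++ [.activated m] }
      let o' := requesterAlive Y ρ k L o.1
      (o'.1, o.2 ++ o'.2)
    match a, r with
    | .message m, _ => activate (some m)
    | .activateRequester, _ => activate none
    | a, r =>
      let o := requesterAlive Y ρ k L y
      (o.1, logOps [(a, r)] ++ o.2)

/-- The operations on the dictionary in the terminate phase. -/
def terminateOps : List (Option (BitVec secp) × Bool) → List (DictOp (BitVec secp) V)
  | [] => []
  | (some t, false) :: l => .delete t :: terminateOps l
  | _ :: l => terminateOps l

/-- The distribution of the messages from and to the environment, in the remaining execution: they do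
not depend on the state of the collector. -/
noncomputable def logDist (Z : Environment (mlCollector learn delete secp I) M) (ρZ : Z.Rand) :
    ℕ → EnvLog (mlCollector learn delete secp I) M →
      PMF (EnvLog (mlCollector learn delete secp I) M)
  | 0, _ => PMF.pure []
  | n + 1, log =>
    match Z.act ρZ log with
    | .finish => PMF.pure [(.finish, none)]
    | .collect v => (keyDist secp).bind fun key =>
        (logDist Z ρZ n (log ++ [(.collect v,
          (some key : Option (mlCollector learn delete secp I).Reply))])).map fun L =>
            (.collect v, (some key : Option (mlCollector learn delete secp I).Reply)) :: L
    | a => (logDist Z ρZ n (log ++ [(a, none)])).map fun L => (a, none) :: L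

theorem mem_support_keyDist (key : BitVec secp) : key ∈ (keyDist secp).support := by
  rw [keyDist, PMF.mem_support_map_iff]
  exact ⟨key.toFin, by simp, rfl⟩

theorem requesterRun_ne_nil {Y : DeletionRequester (mlCollector learn delete secp I) M}
    {ρ : Y.Rand} (k : BitVec secp) (n : ℕ)
    (y : RequesterState (mlCollector learn delete secp I) M) (hy : y.instances ≠ []) :
    (requesterRun Y ρ k n y).1.instances ≠ [] := by
  cases n with
  | zero => exact hy
  | succ n =>
    rw [requesterRun]
    split
    · exact hy
    · simp [hy]
    · split
      · simpa using hy
      · exact hy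

/-- The key enters only through the reply to a first instance. -/
theorem requesterRun_congr {Y : DeletionRequester (mlCollector learn delete secp I) M}
    {ρ : Y.Rand} (k k' : BitVec secp) (n : ℕ)
    (y : RequesterState (mlCollector learn delete secp I) M) (hy : y.instances ≠ []) :
    requesterRun Y ρ k n y = requesterRun Y ρ k' n y := by
  cases n with
  | zero => rfl
  | succ n =>
    rw [requesterRun, requesterRun]
    split
    · rfl
    · simp [hy]
    · rfl

theorem requesterAlive_congr {Y : DeletionRequester (mlCollector learn delete secp I) M}
    {ρ : Y.Rand} (k k' : BitVec secp) (L : EnvLog (mlCollector learn delete secp I) M)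
    (y : RequesterState (mlCollector learn delete secp I) M) (hy : y.instances ≠ []) :
    requesterAlive Y ρ k L y = requesterAlive Y ρ k' L y := by
  induction L generalizing y with
  | nil => rfl
  | cons e L ih =>
    obtain ⟨a, r⟩ := e
    cases a <;> simp only [requesterAlive]
    case message m =>
      rw [requesterRun_congr k k' _ _ (by exact hy), ih _ (requesterRun_ne_nil _ _ _ (by exact hy))]
    case activateRequester =>
      rw [requesterRun_congr k k' _ _ (by exact hy), ih _ (requesterRun_ne_nil _ _ _ (by exact hy))]
    all_goals rw [ih _ hy]

theorem collectorDist_bind_activate_insert (hI : I.HistoryIndependent) (v : V)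
    (x : TrainState (BitVec secp) V) (hx : x.Valid) {β : Type*}
    (f : (mlCollector learn delete secp I).State × Option (mlCollector learn delete secp I).Reply →
      PMF β) :
    ((collectorDist learn delete I x).bind fun s =>
        ((mlCollector learn delete secp I).activate (some (.insert v)) s).bind f) =
      (keyDist secp).bind fun key =>
        (collectorDist learn delete I (x.step (.insert key v))).bind fun s => f (s, some key) := by
  refine (PMF.bind_bind _ (mlInsert learn I v) f).symm.trans ?_
  refine (congrArg (fun p => p.bind f) (stateDist_bind_mlInsert learn hI v x hx)).trans ?_
  refine (PMF.bind_bind _ _ _).trans ?_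
  exact congrArg _ (funext fun key => PMF.bind_map _ _ _)

theorem collectorDist_bind_activate_delete (hdelete : IsDataDeletion learn delete)
    (hI : I.HistoryIndependent) (key : BitVec secp) (x : TrainState (BitVec secp) V)
    (hx : x.Valid) {β : Type*} (f : (mlCollector learn delete secp I).State × Option (mlCollector learn delete secp I).Reply →
      PMF β) :
    ((collectorDist learn delete I x).bind fun s =>
        ((mlCollector learn delete secp I).activate (some (.delete key)) s).bind f) =
      (collectorDist learn delete I (x.step (.delete key))).bind fun s => f (s, none) := by
  unfold collectorDist
  rw [← stateDist_bind_mlDelete hdelete hI key x hx]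
  refine Eq.trans ?_ (PMF.bind_bind _ _ _).symm
  exact congrArg _ (funext fun s => PMF.bind_map _ _ _)

/-- With at most one instance, one key drawn in advance can stand for the reply; a run without an
instance leaves it unused. A deletion gets no reply and ends the run. -/
theorem collectorDist_bind_run (hdelete : IsDataDeletion learn delete) (hI : I.HistoryIndependent)
    {Y : DeletionRequester (mlCollector learn delete secp I) M} {ρ : Y.Rand} (n : ℕ)
    (y : RequesterState (mlCollector learn delete secp I) M) (x : TrainState (BitVec secp) V)
    (hx : x.Valid)
    (hY : ∀ o ∈ ((collectorDist learn delete I x).bind (Y.run ρ n y)).support, o.1.instances.length ≤ 1) :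
    (collectorDist learn delete I x).bind (Y.run ρ n y) = (keyDist secp).bind fun k =>
      (collectorDist learn delete I (x.run (requesterRun Y ρ k n y).2)).map fun s =>
        ((requesterRun Y ρ k n y).1, s) := by
  induction n generalizing x y with
  | zero =>
    simp only [requesterRun, PMF.bind_const]
    rfl
  | succ n ih =>
    cases h : Y.act ρ y.log with
    | halt =>
      simp only [requesterRun, h, PMF.bind_const, TrainState.run]
      simp only [DeletionRequester.run, h]
      rfl
    | collect v =>
      have hrun : (collectorDist learn delete I x).bind (Y.run ρ (n + 1) y) =
          (keyDist secp).bind fun k => (collectorDist learn delete I (x.step (.insert k v))).bind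
            (Y.run ρ n (y.receive k)) := by
        refine Eq.trans ?_ (collectorDist_bind_activate_insert (delete := delete) hI v x hx fun o =>
          o.2.elim (PMF.pure (⟨y.log, y.instances ++ [(none, false)]⟩, o.1))
            fun k => Y.run ρ n (y.receive k) o.1)
        refine congrArg _ (funext fun s => ?_)
        simp only [DeletionRequester.run, h]
        refine congrArg _ (funext fun o => ?_)
        obtain ⟨s', _ | r⟩ := o <;> rfl
      rw [hrun] at hY ⊢
      have hY' : ∀ k, ∀ o ∈ ((collectorDist learn delete I (x.step (.insert k v))).bind
          (Y.run ρ n (y.receive k))).support, o.1.instances.length ≤ 1 := fun k o ho =>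
        hY o ((PMF.mem_support_bind_iff _ _ _).2 ⟨k, mem_support_keyDist k, ho⟩)
      by_cases hy : y.instances = []
      · refine congrArg _ (funext fun k => ?_)
        rw [ih _ _ (hx.step _) (hY' k)]
        simp only [requesterRun, h, hy, List.isEmpty_nil, if_true, TrainState.run]
        -- After the first reply the key drawn by `ih` is irrelevant.
        refine Eq.trans ?_ (PMF.bind_const (keyDist secp) (PMF.map _ _))
        refine congrArg _ (funext fun k' => ?_)
        rw [requesterRun_congr k' k _ _ (y.receive_ne_nil k)]
      · exfalso
        -- A second instance would have positive probability, against `hY`; the key `0` is an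
        -- arbitrary one.
        obtain ⟨o, ho⟩ := ((collectorDist learn delete I (x.step (.insert 0 v))).bind
          (Y.run ρ n (y.receive 0))).support_nonempty
        have h1 := hY' 0 o ho
        obtain ⟨s, -, hs⟩ := (PMF.mem_support_bind_iff _ _ _).1 ho
        have h2 := Y.length_le_of_mem_support_run ρ _ _ _ o hs
        have h3 := List.length_pos_iff.2 hy
        rw [y.length_receive] at h2
        omega
    | delete j =>
      simp only [requesterRun, h, PMF.bind_const]
      simp only [DeletionRequester.run, h]
      rcases y.instances[j]? with _ | ⟨_ | t, b⟩
      · rfl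
      · rfl
      · refine Eq.trans ?_ (collectorDist_bind_activate_delete hdelete hI t x hx fun o =>
          o.2.elim (PMF.pure (⟨y.log, y.instances.set j (some t, true)⟩, o.1))
            fun k => Y.run ρ n ⟨y.log ++ [.reply k], y.instances.set j (some t, true)⟩ o.1)
        refine congrArg _ (funext fun s => congrArg (PMF.bind
          ((mlCollector learn delete secp I).activate (some (.delete t)) s)) (funext fun o => ?_))
        obtain ⟨s', _ | r⟩ := o <;> rfl

theorem collectorDist_bind_terminatePhase (hdelete : IsDataDeletion learn delete)
    (hI : I.HistoryIndependent) (l : List (Option (BitVec secp) × Bool))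
    (x : TrainState (BitVec secp) V) (hx : x.Valid) :
    (collectorDist learn delete I x).bind (terminatePhase (mlCollector learn delete secp I) l) =
      collectorDist learn delete I (x.run (terminateOps l)) := by
  induction l generalizing x with
  | nil => exact PMF.bind_pure _
  | cons e l ih =>
    obtain ⟨t, b⟩ := e
    cases t with
    | none => exact ih x hx
    | some t =>
      cases b with
      | true => exact ih x hx
      | false =>
        rw [terminateOps, TrainState.run, ← ih _ (hx.step _)]
        exact collectorDist_bind_activate_delete hdelete hI t x hx fun o =>
          terminatePhase (mlCollector learn delete secp I) l o.1

end Execution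

/-! ### Factorization of the alive phase -/

section Execution

variable {V H M : Type*} {learn : List V → PMF H} {delete : List V → H → ℕ → PMF H} {secp : ℕ}
  {I : DictImpl (BitVec secp) V}

/-- This dichotomy, the same for all keys, allows the keys drawn for successive activations to be
merged into one. -/
theorem requesterRun_eq_or_ne_nil {Y : DeletionRequester (mlCollector learn delete secp I) M}
    {ρ : Y.Rand} (n : ℕ) (y : RequesterState (mlCollector learn delete secp I) M) :
    (∀ k, requesterRun Y ρ k n y = (y, [])) ∨
      ∀ k, (requesterRun Y ρ k n y).1.instances ≠ [] := by
  by_cases hy : y.instances = []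
  · cases n with
    | zero => exact Or.inl fun _ => rfl
    | succ n =>
      cases h : Y.act ρ y.log with
      | halt => exact Or.inl fun k => by simp only [requesterRun, h]
      | collect v =>
        refine Or.inr fun k => ?_
        simp only [requesterRun, h, hy, List.isEmpty_nil, if_true]
        exact requesterRun_ne_nil k n _ (y.receive_ne_nil k)
      | delete j => exact Or.inl fun k => by simp [requesterRun, h, hy]
  · exact Or.inr fun k => requesterRun_ne_nil k n y hy

theorem collectorDist_bind_activation (hdelete : IsDataDeletion learn delete)
    (hI : I.HistoryIndependent) {Z : Environment (mlCollector learn delete secp I) M}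
    {Y : DeletionRequester (mlCollector learn delete secp I) M} {ρZ : Z.Rand} {ρ : Y.Rand}
    (n b : ℕ) (log : EnvLog (mlCollector learn delete secp I) M)
    (y : RequesterState (mlCollector learn delete secp I) M) (x : TrainState (BitVec secp) V)
    (hx : x.Valid)
    (ih : ∀ (y : RequesterState (mlCollector learn delete secp I) M)
      (x : TrainState (BitVec secp) V), x.Valid →
      (∀ c ∈ ((collectorDist learn delete I x).bind fun s => alivePhase Z Y ρZ ρ n ⟨log, y, s⟩).support,
        c.requester.instances.length ≤ 1) →
      ((collectorDist learn delete I x).bind fun s => alivePhase Z Y ρZ ρ n ⟨log, y, s⟩) =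
        (logDist Z ρZ n log).bind fun L => (keyDist secp).bind fun k =>
          (collectorDist learn delete I (x.run (requesterAlive Y ρ k L y).2)).map fun s =>
            ⟨log ++ L, (requesterAlive Y ρ k L y).1, s⟩)
    (hY : ∀ c ∈ ((collectorDist learn delete I x).bind fun s => (Y.run ρ b y s).bind fun o =>
      alivePhase Z Y ρZ ρ n ⟨log, o.1, o.2⟩).support, c.requester.instances.length ≤ 1) :
    ((collectorDist learn delete I x).bind fun s => (Y.run ρ b y s).bind fun o =>
      alivePhase Z Y ρZ ρ n ⟨log, o.1, o.2⟩) =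
      (logDist Z ρZ n log).bind fun L => (keyDist secp).bind fun k =>
        (collectorDist learn delete I (x.run ((requesterRun Y ρ k b y).2 ++
          (requesterAlive Y ρ k L (requesterRun Y ρ k b y).1).2))).map fun s =>
            ⟨log ++ L, (requesterAlive Y ρ k L (requesterRun Y ρ k b y).1).1, s⟩ := by
  have hbb : ((collectorDist learn delete I x).bind fun s => (Y.run ρ b y s).bind fun o =>
      alivePhase Z Y ρZ ρ n ⟨log, o.1, o.2⟩) = ((collectorDist learn delete I x).bind (Y.run ρ b y)).bind
        fun o => alivePhase Z Y ρZ ρ n ⟨log, o.1, o.2⟩ := (PMF.bind_bind _ _ _).symm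
  rw [hbb] at hY ⊢
  have hrun := collectorDist_bind_run hdelete hI b y x hx (ρ := ρ) fun o ho => by
    obtain ⟨c, hc⟩ := (alivePhase Z Y ρZ ρ n ⟨log, o.1, o.2⟩).support_nonempty
    exact (alivePhase_support (R := fun l l' => l.length ≤ l'.length) (fun _ => le_rfl)
      (fun _ _ _ => le_trans) (Y.length_le_of_mem_support_run ρ) n _ c hc).trans
      (hY c ((PMF.mem_support_bind_iff _ _ _).2 ⟨o, ho, hc⟩))
  rw [hrun, PMF.bind_bind] at hY ⊢
  simp only [PMF.bind_map] at hY ⊢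
  have hstep : ∀ k, (collectorDist learn delete I (x.run (requesterRun Y ρ k b y).2)).bind
      ((fun o => alivePhase Z Y ρZ ρ n ⟨log, o.1, o.2⟩) ∘
        fun s => ((requesterRun Y ρ k b y).1, s)) =
      (logDist Z ρZ n log).bind fun L => (keyDist secp).bind fun k' =>
        (collectorDist learn delete I ((x.run (requesterRun Y ρ k b y).2).run
          (requesterAlive Y ρ k' L (requesterRun Y ρ k b y).1).2)).map fun s =>
            ⟨log ++ L, (requesterAlive Y ρ k' L (requesterRun Y ρ k b y).1).1, s⟩ := fun k =>
    ih _ _ (hx.run _) fun c hc =>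
      hY c ((PMF.mem_support_bind_iff _ _ _).2 ⟨k, mem_support_keyDist k, hc⟩)
  simp only [hstep, TrainState.run_append]
  rw [PMF.bind_comm]
  refine congrArg _ (funext fun L => ?_)
  -- Two keys are drawn, `k` for this activation and `k'` for the rest. If the run does nothing, `k`
  -- is unused; otherwise the rest does not depend on `k'`.
  rcases requesterRun_eq_or_ne_nil (Y := Y) (ρ := ρ) b y with h | h
  · simp only [h, PMF.bind_const]
  · refine congrArg _ (funext fun k => ?_)
    refine Eq.trans (congrArg _ (funext fun k' => ?_)) (PMF.bind_const (keyDist secp) _)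
    rw [requesterAlive_congr k' k _ _ (h k)]

/-- Since replies are independent of the state, the log and the requester's key can be drawn before
the collector's state. -/
theorem collectorDist_bind_alivePhase (hdelete : IsDataDeletion learn delete)
    (hI : I.HistoryIndependent) {Z : Environment (mlCollector learn delete secp I) M}
    {Y : DeletionRequester (mlCollector learn delete secp I) M} {ρZ : Z.Rand} {ρ : Y.Rand}
    (n : ℕ) (log : EnvLog (mlCollector learn delete secp I) M)
    (y : RequesterState (mlCollector learn delete secp I) M) (x : TrainState (BitVec secp) V)
    (hx : x.Valid)
    (hY : ∀ c ∈ ((collectorDist learn delete I x).bind fun s => alivePhase Z Y ρZ ρ n ⟨log, y, s⟩).support,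
      c.requester.instances.length ≤ 1) :
    ((collectorDist learn delete I x).bind fun s => alivePhase Z Y ρZ ρ n ⟨log, y, s⟩) =
      (logDist Z ρZ n log).bind fun L => (keyDist secp).bind fun k =>
        (collectorDist learn delete I (x.run (requesterAlive Y ρ k L y).2)).map fun s =>
          ⟨log ++ L, (requesterAlive Y ρ k L y).1, s⟩ := by
  induction n generalizing log y x with
  | zero =>
    simp only [logDist, PMF.pure_bind, requesterAlive, PMF.bind_const, List.append_nil,
      TrainState.run]
    rfl
  | succ n ih =>
    have hact : ∀ a : EnvAction V (mlCollector learn delete secp I).Token M, ∀ m,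
        (∀ s, alivePhase Z Y ρZ ρ (n + 1) ⟨log, y, s⟩ =
          (Y.run ρ Y.budget ⟨y.log ++ [.activated m], y.instances⟩ s).bind fun o =>
            alivePhase Z Y ρZ ρ n ⟨log ++ [(a, none)], o.1, o.2⟩) →
        logDist Z ρZ (n + 1) log =
          (logDist Z ρZ n (log ++ [(a, none)])).map (fun L => (a, none) :: L) →
        (∀ k L, requesterAlive Y ρ k ((a, none) :: L) y =
          let o := requesterRun Y ρ k Y.budget { y with log := y.log ++ [.activated m] }
          let o' := requesterAlive Y ρ k L o.1
          (o'.1, o.2 ++ o'.2)) →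
        ((collectorDist learn delete I x).bind fun s => alivePhase Z Y ρZ ρ (n + 1) ⟨log, y, s⟩) =
          (logDist Z ρZ (n + 1) log).bind fun L => (keyDist secp).bind fun k =>
            (collectorDist learn delete I (x.run (requesterAlive Y ρ k L y).2)).map fun s =>
              ⟨log ++ L, (requesterAlive Y ρ k L y).1, s⟩ := by
      intro a m h1 h2 h3
      simp only [h1] at hY ⊢
      rw [collectorDist_bind_activation hdelete hI n _ _ _ x hx (fun y x => ih _ y x) hY, h2,
        PMF.bind_map]
      simp only [Function.comp_def, h3, List.append_assoc, List.singleton_append]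
    cases h : Z.act ρZ log with
    | message m =>
      refine hact (.message m) (some m) (fun s => ?_) ?_ fun k L => rfl
      · simp only [alivePhase, h, envStep]
        exact PMF.bind_map _ _ _
      · simp only [logDist, h]
    | activateRequester =>
      refine hact .activateRequester none (fun s => ?_) ?_ fun k L => rfl
      · simp only [alivePhase, h, envStep]
        exact PMF.bind_map _ _ _
      · simp only [logDist, h]
    | activateCollector =>
      have h1 : ∀ s, alivePhase Z Y ρZ ρ (n + 1) ⟨log, y, s⟩ =
          alivePhase Z Y ρZ ρ n ⟨log ++ [(.activateCollector, none)], y, s⟩ := fun s => by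
        simp only [alivePhase, h, envStep]
        exact (PMF.bind_map _ _ _).trans (PMF.pure_bind _ _)
      simp only [h1] at hY ⊢
      rw [ih _ _ _ hx hY]
      simp only [logDist, h]
      rw [PMF.bind_map]
      simp only [Function.comp_def, requesterAlive, logOps, List.append_assoc,
        List.singleton_append, List.nil_append]
    | finish =>
      simp only [alivePhase, h, envStep, logDist, PMF.pure_bind, requesterAlive, logOps,
        PMF.bind_const, List.append_nil, TrainState.run]
      rfl
    | collect v =>
      have h1 : ((collectorDist learn delete I x).bind fun s =>
          alivePhase Z Y ρZ ρ (n + 1) ⟨log, y, s⟩) = (keyDist secp).bind fun key =>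
            (collectorDist learn delete I (x.step (.insert key v))).bind fun s =>
              alivePhase Z Y ρZ ρ n ⟨log ++ [(.collect v,
                (some key : Option (mlCollector learn delete secp I).Reply))], y, s⟩ := by
        refine Eq.trans (congrArg _ (funext fun s => ?_)) (collectorDist_bind_activate_insert
          (delete := delete) hI v x hx fun o =>
            alivePhase Z Y ρZ ρ n ⟨log ++ [(.collect v, o.2)], y, o.1⟩)
        simp only [alivePhase, h, envStep]
        exact PMF.bind_map _ _ _
      rw [h1] at hY ⊢
      simp only [logDist, h]
      rw [PMF.bind_bind]
      refine congrArg _ (funext fun key => ?_)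
      rw [ih _ _ _ (hx.step _) fun c hc =>
        hY c ((PMF.mem_support_bind_iff _ _ _).2 ⟨key, mem_support_keyDist key, hc⟩), PMF.bind_map]
      simp only [Function.comp_def, requesterAlive, logOps, List.append_assoc,
        List.singleton_append, TrainState.run]
    | delete key =>
      have h1 : ((collectorDist learn delete I x).bind fun s =>
          alivePhase Z Y ρZ ρ (n + 1) ⟨log, y, s⟩) =
            (collectorDist learn delete I (x.step (.delete key))).bind fun s =>
              alivePhase Z Y ρZ ρ n ⟨log ++ [(.delete key, none)], y, s⟩ := by
        refine Eq.trans (congrArg _ (funext fun s => ?_)) (collectorDist_bind_activate_delete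
          hdelete hI key x hx fun o =>
            alivePhase Z Y ρZ ρ n ⟨log ++ [(.delete key, o.2)], y, o.1⟩)
        simp only [alivePhase, h, envStep]
        exact PMF.bind_map _ _ _
      rw [h1] at hY ⊢
      simp only [logDist, h]
      rw [ih _ _ _ (hx.step _) hY, PMF.bind_map]
      simp only [Function.comp_def, requesterAlive, logOps, List.append_assoc,
        List.singleton_append, TrainState.run]

end Execution

/-! ### Operation sequences of the real and the ideal execution -/

section Execution

variable {V H M : Type*} {learn : List V → PMF H} {delete : List V → H → ℕ → PMF H} {secp : ℕ}
  {I : DictImpl (BitVec secp) V}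

/-- All operations on the dictionary, including the terminate phase. -/
def allOps (Y : DeletionRequester (mlCollector learn delete secp I) M) (ρ : Y.Rand)
    (k : BitVec secp) (L : EnvLog (mlCollector learn delete secp I) M)
    (y : RequesterState (mlCollector learn delete secp I) M) : List (DictOp (BitVec secp) V) :=
  (requesterAlive Y ρ k L y).2 ++ terminateOps (requesterAlive Y ρ k L y).1.instances

theorem exec_eq (hdelete : IsDataDeletion learn delete) (hI : I.HistoryIndependent)
    (hsecp : 1 ≤ secp) (Z : Environment (mlCollector learn delete secp I) M)
    (Y : DeletionRequester (mlCollector learn delete secp I) M)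
    (hY : ∀ o ∈ (aliveOutcome Z Y).support, o.2.requester.instances.length ≤ 1) :
    exec Z Y = Z.coins.bind fun ρZ => Y.coins.bind fun ρ =>
      (PMF.uniformOfFinset (Finset.Icc secp (2 * secp))
        ⟨secp, Finset.mem_Icc.mpr ⟨le_rfl, by omega⟩⟩).bind fun thr =>
        (logDist Z ρZ Z.budget []).bind fun L => (keyDist secp).bind fun k =>
          (collectorDist learn delete I (TrainState.run (allOps Y ρ k L ⟨[], []⟩)
            (.training (fun _ => none) thr))).map fun s => (s, (ρZ, L)) := by
  have hsetup : (mlCollector learn delete secp I).setup =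
      (PMF.uniformOfFinset (Finset.Icc secp (2 * secp))
        ⟨secp, Finset.mem_Icc.mpr ⟨le_rfl, by omega⟩⟩).bind fun thr =>
          collectorDist learn delete I (.training (fun _ => none) thr) := by
    refine (PMF.bind_comm _ _ _).trans (congrArg _ (funext fun thr => ?_))
    simp only [collectorDist, stateDist, TrainState.content, hI.memDist_empty]
    refine congrArg _ (funext fun m => ?_)
    simp only [Function.comp_def, stateGivenMem, dictSupport_empty, Finset.card_empty]
  have hout : aliveOutcome Z Y = Z.coins.bind fun ρZ => Y.coins.bind fun ρ =>
      (PMF.uniformOfFinset (Finset.Icc secp (2 * secp))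
        ⟨secp, Finset.mem_Icc.mpr ⟨le_rfl, by omega⟩⟩).bind fun thr =>
          ((collectorDist learn delete I (.training (fun _ => none) thr)).bind fun s =>
            alivePhase Z Y ρZ ρ Z.budget ⟨[], ⟨[], []⟩, s⟩).map fun c => (ρZ, c) := by
    rw [aliveOutcome, hsetup]
    simp only [PMF.bind_bind, PMF.map_bind]
  rw [hout] at hY
  rw [exec, hout]
  simp only [PMF.bind_bind, PMF.bind_map]
  refine PMF.bind_congr_of_support fun ρZ hρZ => PMF.bind_congr_of_support fun ρ hρ =>
    PMF.bind_congr_of_support fun thr hthr => ?_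
  -- The empty dictionary is below the threshold because `thr ≥ secp ≥ 1`.
  have hx : (TrainState.training (fun _ : BitVec secp => (none : Option V)) thr).Valid := by
    have := (PMF.mem_support_uniformOfFinset_iff _ _).1 hthr
    rw [Finset.mem_Icc] at this
    change (dictSupport _).card < thr
    rw [dictSupport_empty, Finset.card_empty]
    omega
  have halive := collectorDist_bind_alivePhase hdelete hI (Z := Z) (Y := Y) (ρZ := ρZ) (ρ := ρ)
    Z.budget [] ⟨[], []⟩ _ hx fun c hc => hY (ρZ, c) <| by
      simp only [PMF.mem_support_bind_iff, PMF.mem_support_map_iff] at hc ⊢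
      exact ⟨ρZ, hρZ, ρ, hρ, thr, hthr, c, hc, rfl⟩
  rw [← PMF.bind_bind, halive]
  simp only [PMF.bind_bind, PMF.bind_map]
  refine congrArg _ (funext fun L => congrArg _ (funext fun k => ?_))
  rw [allOps, TrainState.run_append]
  refine Eq.trans ?_ (congrArg (PMF.map fun s => (s, (ρZ, L)))
    (collectorDist_bind_terminatePhase hdelete hI _ _ (hx.run _)))
  refine Eq.trans ?_ (PMF.map_bind _ _ _).symm
  rfl

theorem logOps_cons (e : EnvAction V (mlCollector learn delete secp I).Token M ×
      Option (mlCollector learn delete secp I).Reply)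
    (L : EnvLog (mlCollector learn delete secp I) M) :
    logOps (e :: L) = logOps [e] ++ logOps L := by
  obtain ⟨a, _ | r⟩ := e <;> cases a <;> rfl

theorem map_getD_map_some {K : Type*} (o : DictOp K V) (l : List (DictOp K V)) :
    ((l.map some).map fun x => x.getD o) = l := by
  induction l with
  | nil => rfl
  | cons a l ih => simp

theorem reduceOption_map_some {K : Type*} (l : List (DictOp K V)) :
    (l.map some).reduceOption = l := by
  induction l with
  | nil => rfl
  | cons a l ih => simpa using ih

/-- The only possible operation is a deletion of `k₀`, recorded in `W` as `none`. The last clause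
holds because the flag is set only along with such a deletion. -/
theorem requesterRun_of_instances {Y : DeletionRequester (mlCollector learn delete secp I) M}
    {ρ : Y.Rand} (k k₀ : BitVec secp) (b : Bool) (n : ℕ)
    (y : RequesterState (mlCollector learn delete secp I) M) (hy : y.instances = [(some k₀, b)]) :
    ∃ (b' : Bool) (W : List (Option (DictOp (BitVec secp) V))),
      (requesterRun Y ρ k n y).1.instances = [(some k₀, b')] ∧
      (requesterRun Y ρ k n y).2 = (W.map fun o => o.getD (.delete k₀)) ∧
      W.reduceOption = [] ∧ (b' = true → b = true ∨ none ∈ W) := by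
  have hidle : ∀ o, o = (y, []) → ∃ (b' : Bool) (W : List (Option (DictOp (BitVec secp) V))),
      o.1.instances = [(some k₀, b')] ∧ o.2 = (W.map fun o => o.getD (.delete k₀)) ∧
      W.reduceOption = [] ∧ (b' = true → b = true ∨ none ∈ W) := by
    rintro o rfl
    exact ⟨b, [], hy, rfl, rfl, Or.inl⟩
  cases n with
  | zero => exact hidle _ rfl
  | succ n =>
    cases h : Y.act ρ y.log with
    | halt => exact hidle _ (by simp only [requesterRun, h])
    | collect v => exact hidle _ (by simp [requesterRun, h, hy]; rfl)
    | delete j =>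
      cases j with
      | zero =>
        refine ⟨true, [none], ?_, ?_, rfl, fun _ => Or.inr (by simp)⟩
        · simp only [requesterRun, h, hy]
          rfl
        · simp only [requesterRun, h, hy]
          rfl
      | succ j =>
        refine hidle _ ?_
        simp only [requesterRun, h, hy]
        rfl

/-- A deletion that `Y` has not requested is made up for in the terminate phase, whence `none ∈ W`.
-/
theorem allOps_of_instances {Y : DeletionRequester (mlCollector learn delete secp I) M}
    {ρ : Y.Rand} (k k₀ : BitVec secp) (L : EnvLog (mlCollector learn delete secp I) M) (b : Bool)
    (y : RequesterState (mlCollector learn delete secp I) M) (hy : y.instances = [(some k₀, b)]) :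
    ∃ W : List (Option (DictOp (BitVec secp) V)),
      allOps Y ρ k L y = (W.map fun o => o.getD (.delete k₀)) ∧ W.reduceOption = logOps L ∧
      (b = false → none ∈ W) := by
  induction L generalizing b y with
  | nil =>
    cases b with
    | true => exact ⟨[], by simp only [allOps, requesterAlive, hy]; rfl, rfl, by simp⟩
    | false => exact ⟨[none], by simp only [allOps, requesterAlive, hy]; rfl, rfl, by simp⟩
  | cons e L ih =>
    obtain ⟨a, r⟩ := e
    have hact : ∀ m, allOps Y ρ k ((a, r) :: L) y =
        (requesterRun Y ρ k Y.budget ⟨y.log ++ [.activated m], y.instances⟩).2 ++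
          allOps Y ρ k L (requesterRun Y ρ k Y.budget ⟨y.log ++ [.activated m], y.instances⟩).1 →
        logOps [(a, r)] = [] → ∃ W : List (Option (DictOp (BitVec secp) V)),
          allOps Y ρ k ((a, r) :: L) y = (W.map fun o => o.getD (.delete k₀)) ∧
          W.reduceOption = logOps ((a, r) :: L) ∧ (b = false → none ∈ W) := by
      intro m h1 h2
      obtain ⟨b', W, hb', hW, hW', hn⟩ := requesterRun_of_instances (ρ := ρ) k k₀ b Y.budget
        ⟨y.log ++ [.activated m], y.instances⟩ hy
      obtain ⟨W₁, hW₁, hW₁', hn₁⟩ := ih b' _ hb'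
      refine ⟨W ++ W₁, ?_, ?_, fun hb => ?_⟩
      · rw [h1, hW, hW₁, List.map_append]
      · rw [logOps_cons, h2, List.reduceOption_append, hW', hW₁']
      · cases b' with
        | false => exact List.mem_append_right _ (hn₁ rfl)
        | true => exact List.mem_append_left _ ((hn rfl).resolve_left (by simp [hb]))
    have hother : allOps Y ρ k ((a, r) :: L) y = logOps [(a, r)] ++ allOps Y ρ k L y →
        ∃ W : List (Option (DictOp (BitVec secp) V)),
          allOps Y ρ k ((a, r) :: L) y = (W.map fun o => o.getD (.delete k₀)) ∧
          W.reduceOption = logOps ((a, r) :: L) ∧ (b = false → none ∈ W) := by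
      intro h1
      obtain ⟨W, hW, hW', hn⟩ := ih b y hy
      refine ⟨(logOps [(a, r)]).map some ++ W, ?_, ?_, fun hb =>
        List.mem_append_right _ (hn hb)⟩
      · rw [h1, hW, List.map_append, map_getD_map_some]
      · rw [logOps_cons (a, r) L, List.reduceOption_append, reduceOption_map_some, hW']
    cases a
    case message m => exact hact (some m) (List.append_assoc _ _ _) rfl
    case activateRequester => exact hact none (List.append_assoc _ _ _) rfl
    all_goals exact hother (List.append_assoc _ _ _)

theorem requesterRun_of_nil {Y : DeletionRequester (mlCollector learn delete secp I) M}
    {ρ : Y.Rand} (n : ℕ) (y : RequesterState (mlCollector learn delete secp I) M)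
    (hy : y.instances = []) :
    (∀ k, requesterRun Y ρ k n y = (y, [])) ∨ ∃ u, ∀ k,
      ∃ (b : Bool) (W : List (Option (DictOp (BitVec secp) V))),
        (requesterRun Y ρ k n y).1.instances = [(some k, b)] ∧
        (requesterRun Y ρ k n y).2 = .insert k u :: (W.map fun o => o.getD (.delete k)) ∧
        W.reduceOption = [] ∧ (b = true → none ∈ W) := by
  cases n with
  | zero => exact Or.inl fun _ => rfl
  | succ n =>
    cases h : Y.act ρ y.log with
    | halt => exact Or.inl fun k => by simp only [requesterRun, h]
    | collect v =>
      refine Or.inr ⟨v, fun k => ?_⟩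
      obtain ⟨b, W, h1, h2, h3, h4⟩ := requesterRun_of_instances (ρ := ρ) k k false n
        (y.receive k) (by simp only [RequesterState.receive, hy]; rfl)
      refine ⟨b, W, ?_, ?_, h3, fun hb => (h4 hb).resolve_left (by simp)⟩
      · simp only [requesterRun, h, hy, List.isEmpty_nil, if_true]
        exact h1
      · simp only [requesterRun, h, hy, List.isEmpty_nil, if_true]
        rw [h2]
    | delete j => exact Or.inl fun k => by simp [requesterRun, h, hy]

/-- The deletion-requester has no effect, or it inserts an entry that is deleted later. -/
theorem allOps_of_nil {Y : DeletionRequester (mlCollector learn delete secp I) M} {ρ : Y.Rand}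
    (L : EnvLog (mlCollector learn delete secp I) M)
    (y : RequesterState (mlCollector learn delete secp I) M) (hy : y.instances = []) :
    (∀ k, allOps Y ρ k L y = logOps L) ∨ ∃ A B u, logOps L = A ++ B ∧ ∀ k,
      ∃ W : List (Option (DictOp (BitVec secp) V)),
        allOps Y ρ k L y = A ++ .insert k u :: (W.map fun o => o.getD (.delete k)) ∧
        W.reduceOption = B ∧ none ∈ W := by
  induction L generalizing y with
  | nil => exact Or.inl fun k => by simp only [allOps, requesterAlive, hy]; rfl
  | cons e L ih =>
    obtain ⟨a, r⟩ := e
    have hother : ∀ y' : RequesterState (mlCollector learn delete secp I) M, y'.instances = [] →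
        (∀ k, allOps Y ρ k ((a, r) :: L) y = logOps [(a, r)] ++ allOps Y ρ k L y') →
        (∀ k, allOps Y ρ k ((a, r) :: L) y = logOps ((a, r) :: L)) ∨
          ∃ A B u, logOps ((a, r) :: L) = A ++ B ∧ ∀ k,
            ∃ W : List (Option (DictOp (BitVec secp) V)),
              allOps Y ρ k ((a, r) :: L) y =
                A ++ .insert k u :: (W.map fun o => o.getD (.delete k)) ∧
              W.reduceOption = B ∧ none ∈ W := by
      intro y' hy' h1
      rcases ih y' hy' with h | ⟨A, B, u, hAB, h⟩
      · exact Or.inl fun k => by rw [h1, h, ← logOps_cons]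
      · refine Or.inr ⟨logOps [(a, r)] ++ A, B, u, ?_, fun k => ?_⟩
        · rw [logOps_cons, hAB, List.append_assoc]
        · obtain ⟨W, hW, hB, hn⟩ := h k
          exact ⟨W, by rw [h1, hW, List.append_assoc], hB, hn⟩
    have hact : ∀ m, (∀ k, allOps Y ρ k ((a, r) :: L) y =
        (requesterRun Y ρ k Y.budget ⟨y.log ++ [.activated m], y.instances⟩).2 ++
          allOps Y ρ k L
            (requesterRun Y ρ k Y.budget ⟨y.log ++ [.activated m], y.instances⟩).1) →
        logOps [(a, r)] = [] →
        (∀ k, allOps Y ρ k ((a, r) :: L) y = logOps ((a, r) :: L)) ∨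
          ∃ A B u, logOps ((a, r) :: L) = A ++ B ∧ ∀ k,
            ∃ W : List (Option (DictOp (BitVec secp) V)),
              allOps Y ρ k ((a, r) :: L) y =
                A ++ .insert k u :: (W.map fun o => o.getD (.delete k)) ∧
              W.reduceOption = B ∧ none ∈ W := by
      intro m h1 h2
      rcases requesterRun_of_nil (ρ := ρ) Y.budget ⟨y.log ++ [.activated m], y.instances⟩ hy with
        h | ⟨u, h⟩
      · exact hother ⟨y.log ++ [.activated m], y.instances⟩ hy fun k => by rw [h1, h, h2]
      -- The instance starts here, so the prefix is empty and `B` is the rest of the log. `Y` has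
      -- not yet seen `k`, so `u` does not depend on it; only `W` does.
      · refine Or.inr ⟨[], _, u, rfl, fun k => ?_⟩
        obtain ⟨b, W, hb, hW, hW', hn⟩ := h k
        obtain ⟨W₁, hW₁, hW₁', hn₁⟩ := allOps_of_instances (ρ := ρ) k k L b _ hb
        refine ⟨W ++ W₁, ?_, ?_, ?_⟩
        · rw [h1, hW, hW₁, List.map_append]
          rfl
        · rw [logOps_cons, h2, List.reduceOption_append, hW', hW₁']
        · cases b with
          | false => exact List.mem_append_right _ (hn₁ rfl)
          | true => exact List.mem_append_left _ (hn rfl)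
    cases a
    case message m => exact hact (some m) (fun k => List.append_assoc _ _ _) rfl
    case activateRequester => exact hact none (fun k => List.append_assoc _ _ _) rfl
    all_goals exact hother y hy fun k => List.append_assoc _ _ _

theorem allOps_silent (ρ : (DeletionRequester.silent (mlCollector learn delete secp I) M).Rand)
    (k : BitVec secp) (L : EnvLog (mlCollector learn delete secp I) M)
    (y : RequesterState (mlCollector learn delete secp I) M) (hy : y.instances = []) :
    allOps (DeletionRequester.silent (mlCollector learn delete secp I) M) ρ k L y = logOps L := by
  induction L generalizing y with
  | nil => simp only [allOps, requesterAlive, hy]; rfl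
  | cons e L ih =>
    obtain ⟨a, r⟩ := e
    rw [logOps_cons, ← ih y hy]
    cases a
    case message m =>
      rw [ih y hy, ← ih ⟨y.log ++ [.activated (some m)], y.instances⟩ hy]
      rfl
    case activateRequester =>
      rw [ih y hy, ← ih ⟨y.log ++ [.activated none], y.instances⟩ hy]
      rfl
    all_goals exact List.append_assoc _ _ _

theorem instances_silent {Z : Environment (mlCollector learn delete secp I) M} :
    ∀ o ∈ (aliveOutcome Z (DeletionRequester.silent _ M)).support,
      o.2.requester.instances.length ≤ 1 := by
  intro o ho
  simp only [aliveOutcome, PMF.mem_support_bind_iff, PMF.mem_support_map_iff] at ho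
  obtain ⟨ρZ, -, ρ, -, s, -, c, hc, rfl⟩ := ho
  have := alivePhase_support (R := fun l l' => l = l') (fun _ => rfl)
    (fun _ _ _ => Eq.trans) (fun n y s o ho => by
      rw [DeletionRequester.run_silent, PMF.mem_support_pure_iff] at ho
      rw [ho]) _ _ c hc
  simp [← this]

end Execution

/-! ### Comparison of the executions -/

open scoped ENNReal

section Comparison

/-- The probabilities of the outcome `true` differ by at most `ε`. -/
def Near (ε : ℝ≥0∞) (p q : PMF Bool) : Prop :=
  p true ≤ q true + ε ∧ q true ≤ p true + ε

theorem bind_apply_le {α : Type*} (μ : PMF α) {f g : α → PMF Bool} {e : α → ℝ≥0∞}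
    (h : ∀ a, f a true ≤ g a true + e a) :
    μ.bind f true ≤ μ.bind g true + ∑' a, μ a * e a := by
  rw [PMF.bind_apply, PMF.bind_apply, ← ENNReal.tsum_add]
  refine ENNReal.tsum_le_tsum fun a => ?_
  rw [← mul_add]
  exact mul_le_mul_right (h a) _

theorem Near.bind_of_le {α : Type*} (μ : PMF α) {f g : α → PMF Bool} {e : α → ℝ≥0∞} {ε : ℝ≥0∞}
    (h : ∀ a, Near (e a) (f a) (g a)) (he : ∑' a, μ a * e a ≤ ε) :
    Near ε (μ.bind f) (μ.bind g) :=
  ⟨(bind_apply_le μ fun a => (h a).1).trans (by gcongr),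
    (bind_apply_le μ fun a => (h a).2).trans (by gcongr)⟩

theorem Near.bind {α : Type*} (μ : PMF α) {f g : α → PMF Bool} {ε : ℝ≥0∞}
    (h : ∀ a, Near ε (f a) (g a)) : Near ε (μ.bind f) (μ.bind g) :=
  Near.bind_of_le μ h (by rw [ENNReal.tsum_mul_right, μ.tsum_coe, one_mul])

theorem near_one (p q : PMF Bool) : Near 1 p q :=
  ⟨(p.coe_le_one true).trans le_add_self, (q.coe_le_one true).trans le_add_self⟩

theorem Near.mono {ε ε' : ℝ≥0∞} {p q : PMF Bool} (h : Near ε p q) (hε : ε ≤ ε') : Near ε' p q :=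
  ⟨h.1.trans (by gcongr), h.2.trans (by gcongr)⟩

theorem Near.abs_sub_le {ε : ℝ≥0∞} {p q : PMF Bool} (h : Near ε p q) (hε : ε ≠ ∞) :
    |(p true).toReal - (q true).toReal| ≤ ε.toReal := by
  have aux : ∀ p q : PMF Bool, p true ≤ q true + ε →
      (p true).toReal ≤ (q true).toReal + ε.toReal := fun p q h => by
    rw [← ENNReal.toReal_add (q.apply_ne_top _) hε]
    exact ENNReal.toReal_mono (ENNReal.add_ne_top.2 ⟨q.apply_ne_top _, hε⟩) h
  have h1 := aux p q h.1
  have h2 := aux q p h.2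
  rw [abs_le]
  constructor <;> linarith

theorem keyDist_apply {secp : ℕ} (k : BitVec secp) : keyDist secp k = ((2 : ℝ≥0∞) ^ secp)⁻¹ := by
  rw [keyDist, PMF.map_apply, tsum_eq_single k.toFin]
  · simp
  · intro i hi
    rw [if_neg]
    rintro rfl
    exact hi rfl

/-- Comparison outside of a small set of keys. -/
theorem Near.keyDist_bind {secp : ℕ} {f g : BitVec secp → PMF Bool} {ε : ℝ≥0∞}
    (S : Finset (BitVec secp)) (h : ∀ k ∉ S, Near ε (f k) (g k)) :
    Near (ε + S.card * ((2 : ℝ≥0∞) ^ secp)⁻¹) ((keyDist secp).bind f) ((keyDist secp).bind g) := by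
  classical
  -- A key in `S` costs the trivial bound `1`, weighted by its probability.
  refine Near.bind_of_le (e := fun k => ε + if k ∈ S then 1 else 0) _ (fun k => ?_) ?_
  · by_cases hk : k ∈ S
    · simpa [hk] using (near_one _ _).mono le_add_self
    · simpa [hk] using h k hk
  · simp only [mul_add]
    rw [ENNReal.tsum_add, ENNReal.tsum_mul_right, PMF.tsum_coe, one_mul]
    gcongr
    simp only [mul_ite, mul_one, mul_zero]
    rw [tsum_eq_sum (s := S) fun k hk => if_neg hk, Finset.sum_ite_mem, Finset.inter_self]
    simp [keyDist_apply]

/-- Comparison of two families that agree up to a matching of all indices but one. -/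
theorem Near.uniformOfFinset_bind {s : Finset ℕ} (hs : s.Nonempty) {f g : ℕ → PMF Bool} {e : ℕ}
    (he : e ∈ s) {σ : ℕ → ℕ} (hσ : Set.InjOn σ (s.erase e)) (hσs : ∀ i ∈ s.erase e, σ i ∈ s)
    (h : ∀ i ∈ s.erase e, f (σ i) = g i) :
    Near (s.card : ℝ≥0∞)⁻¹ ((PMF.uniformOfFinset s hs).bind f)
      ((PMF.uniformOfFinset s hs).bind g) := by
  have hbind : ∀ f : ℕ → PMF Bool, (PMF.uniformOfFinset s hs).bind f true =
      (s.card : ℝ≥0∞)⁻¹ * ∑ i ∈ s, f i true := by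
    intro f
    rw [PMF.bind_apply, tsum_eq_sum (s := s), Finset.mul_sum]
    · refine Finset.sum_congr rfl fun i hi => ?_
      rw [PMF.uniformOfFinset_apply_of_mem hs hi]
    · intro i hi
      rw [PMF.uniformOfFinset_apply_of_notMem hs hi, zero_mul]
  have himg : ∑ i ∈ (s.erase e).image σ, f i true = ∑ i ∈ s.erase e, g i true := by
    rw [Finset.sum_image hσ]
    exact Finset.sum_congr rfl fun i hi => by rw [h i hi]
  have hsub : (s.erase e).image σ ⊆ s := Finset.image_subset_iff.2 hσs
  -- Each side keeps one unmatched index, the one missed by `σ` and `e`, contributing at most `1`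
  -- before normalization.
  have hcard : (s \ (s.erase e).image σ).card = 1 := by
    rw [Finset.card_sdiff_of_subset hsub, Finset.card_image_of_injOn hσ, Finset.card_erase_of_mem he]
    have := Finset.card_pos.2 hs
    omega
  have hmul : ∀ a b : ℝ≥0∞, a ≤ b + 1 →
      (s.card : ℝ≥0∞)⁻¹ * a ≤ (s.card : ℝ≥0∞)⁻¹ * b + (s.card : ℝ≥0∞)⁻¹ := fun a b hab =>
    calc (s.card : ℝ≥0∞)⁻¹ * a ≤ (s.card : ℝ≥0∞)⁻¹ * (b + 1) := by gcongr
      _ = _ := by rw [mul_add, mul_one]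
  unfold Near
  rw [hbind, hbind]
  refine ⟨hmul _ _ ?_, hmul _ _ ?_⟩
  · rw [← Finset.sum_sdiff hsub, himg, add_comm]
    gcongr
    · exact Finset.erase_subset e s
    · calc ∑ i ∈ s \ (s.erase e).image σ, f i true
          ≤ ∑ i ∈ s \ (s.erase e).image σ, 1 := Finset.sum_le_sum fun i _ => (f i).coe_le_one true
        _ = 1 := by rw [Finset.sum_const, hcard, one_nsmul]
  · rw [← Finset.sum_erase_add s _ he, ← himg]
    gcongr
    exact (g e).coe_le_one true

variable {V H M : Type*} {learn : List V → PMF H} {delete : List V → H → ℕ → PMF H} {secp : ℕ}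
  {I : DictImpl (BitVec secp) V}

theorem near_exec (hdelete : IsDataDeletion learn delete) (hI : I.HistoryIndependent)
    (hsecp : 1 ≤ secp) (Z : Environment (mlCollector learn delete secp I) M)
    (Y : DeletionRequester (mlCollector learn delete secp I) M) (hY : Y.IsRepresentative 1)
    (D : (mlCollector learn delete secp I).State × Z.View → PMF Bool) :
    Near (((secp : ℝ≥0∞) + 1)⁻¹ + ((secp + 2) * (2 * secp) : ℕ) * ((2 : ℝ≥0∞) ^ secp)⁻¹)
      ((exec Z Y).bind D) ((exec Z (DeletionRequester.silent _ M)).bind D) := by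
  have hsilent : ∀ ρ k L, allOps (DeletionRequester.silent (mlCollector learn delete secp I) M)
      ρ k L ⟨[], []⟩ = logOps L := fun ρ k L => allOps_silent ρ k L _ rfl
  rw [exec_eq hdelete hI hsecp Z Y (hY Z), exec_eq hdelete hI hsecp Z _ instances_silent]
  simp only [PMF.bind_bind, PMF.bind_map, hsilent, PMF.bind_const]
  refine Near.bind _ fun ρZ => ?_
  -- The ideal side does not use the coins of `Y`; a void draw lets both sides share them. The same
  -- is done for the key below.
  refine Eq.mp (congrArg (Near _ _) (PMF.bind_const Y.coins _)) ?_
  refine Near.bind _ fun ρ => ?_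
  -- The threshold has to be drawn last, as its matching depends on the log and the key.
  rw [PMF.bind_comm, PMF.bind_comm _ (logDist Z ρZ Z.budget [])]
  refine Near.bind _ fun L => ?_
  rcases allOps_of_nil (Y := Y) (ρ := ρ) L ⟨[], []⟩ rfl with h | ⟨A, B, u, hAB, h⟩
  · simp only [h, PMF.bind_const]
    exact ⟨le_self_add, le_self_add⟩
  · rw [PMF.bind_comm]
    refine Eq.mp (congrArg (Near _ _) (PMF.bind_const (keyDist secp) _)) ?_
    -- The exposed keys are fixed before `k` is drawn.
    refine (Near.keyDist_bind (ε := ((secp : ℝ≥0∞) + 1)⁻¹) (exposedKeys secp A B)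
      fun k hk => ?_).mono ?_
    · obtain ⟨W, hW, rfl, hn⟩ := h k
      obtain ⟨e, he, σ, hσ, H⟩ := exists_threshold_matching u secp hsecp A W hn hk
      have hcard : ((Finset.Icc secp (2 * secp)).card : ℝ≥0∞) = (secp : ℝ≥0∞) + 1 := by
        rw [Nat.card_Icc, show 2 * secp + 1 - secp = secp + 1 by omega]
        push_cast
        rfl
      rw [← hcard, hW, hAB]
      refine Near.uniformOfFinset_bind _ he hσ (fun thr ht => (H thr ht).1) fun thr ht => ?_
      rw [(H thr ht).2]
    · gcongr
      exact card_exposedKeys_le secp hsecp A B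

end Comparison

theorem theorem3p4 {V H M : Type*} (learn : List V → PMF H) (delete : List V → H → ℕ → PMF H)
    (hdelete : IsDataDeletion learn delete)
    (dict : ∀ secp : ℕ, DictImpl (BitVec secp) V)
    (hdict : ∀ secp, (dict secp).HistoryIndependent) :
    ∃ p : Polynomial ℝ, ∀ secp : ℕ, 1 ≤ secp →
      representativeComplianceError (fun n => mlCollector learn delete n (dict n)) M 1 secp ≤
        1 / (secp : ℝ) + p.eval (secp : ℝ) / 2 ^ secp := by
  refine ⟨(Polynomial.X + 2) * (2 * Polynomial.X), fun secp hsecp => ?_⟩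
  have hpos : (0 : ℝ) < secp := by exact_mod_cast hsecp
  have heval : ((Polynomial.X + 2) * (2 * Polynomial.X) : Polynomial ℝ).eval (secp : ℝ) =
      (secp + 2) * (2 * secp) := by simp
  rw [heval]
  refine Real.sSup_le ?_ (by positivity)
  rintro δ ⟨Z, Y, D, -, -, hY, rfl⟩
  have hne : (((secp : ℝ≥0∞) + 1)⁻¹ + ((secp + 2) * (2 * secp) : ℕ) * ((2 : ℝ≥0∞) ^ secp)⁻¹) ≠ ∞ :=
    ENNReal.add_ne_top.2 ⟨by simp, ENNReal.mul_ne_top (ENNReal.natCast_ne_top _) (by simp)⟩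
  refine ((near_exec hdelete (hdict secp) hsecp (Z secp) (Y secp) (hY secp) D).abs_sub_le
    hne).trans ?_
  rw [ENNReal.toReal_add (by simp) (ENNReal.mul_ne_top (ENNReal.natCast_ne_top _) (by simp)), ENNReal.toReal_mul,
    ENNReal.toReal_inv, ENNReal.toReal_inv, ENNReal.toReal_add (by simp) (by simp),
    ENNReal.toReal_pow]
  simp only [ENNReal.toReal_natCast, ENNReal.toReal_one, ENNReal.toReal_ofNat]
  push_cast
  rw [← div_eq_mul_inv, ← one_div]
  gcongr
  linarith
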